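/- Setting. Let $h,m\ge 0$, $N=h+m$, let $\mathcal U,\mathcal V\subseteq\mathbb R^N$ be open, let $\mathbf g,\mathbf f:\mathcal V\to\mathbb R^N$, $\mathbf D:\mathcal V\to\mathbb M^{N\times N}$ and the bijective change of variables $\mathbf v:\mathcal U\to\mathcal V$ be smooth. Assume that, upon inserting $\mathbf v=\mathbf v(\mathbf u)$, expanding the derivatives and multiplying from the left by an invertible matrix depending on $\mathbf u$, the system $\mathbf g(\mathbf v)_t+\mathbf f(\mathbf v)_x=(\mathbf D(\mathbf v)\mathbf v_x)_x$ becomes $$\mathbf E(\mathbf u)\mathbf u_t+\mathbf A(\mathbf u)\mathbf u_x=\mathbf B(\mathbf u)\mathbf u_{xx}+\mathbf G(\mathbf u,\mathbf u_x)\mathbf u_x ,$$ with smooth coefficients such that, for every $\mathbf u\in\mathcal U$ and with respect to the decomposition $\mathbf u=(\mathbf u_1,\mathbf u_2)\in\mathbb R^h\times\mathbb R^{m}$: $\mathbf E$ is symmetric, positive definite and block diagonal; $\mathbf A=\begin{pmatrix}\mathbf A_{11}&\mathbf A_{21}^t\\ \mathbf A_{21}&\mathbf A_{22}\end{pmatrix}$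 is symmetric with $\det\mathbf A_{11}\neq0$; $\mathbf B=\begin{pmatrix}0&0\\0&\mathbf B_{22}\end{pmatrix}$ with $\mathbf B_{22}$ symmetric and positive definite; $\mathbf G=\begin{pmatrix}0&0\\ \mathbf G_1&\mathbf G_2\end{pmatrix}$, where $\mathbf G_1$ depends on $\mathbf u$ and on $\mathbf u_{2,x}$ and vanishes if $\mathbf u_{2,x}=0$, and $\mathbf G_2$ depends on $\mathbf u,\mathbf u_x$ and vanishes if $\mathbf u_x=0$; no eigenvector of $\mathbf E^{-1}\mathbf A$ lies in the kernel of $\mathbf B$. Let $\lambda_1<\dots<\lambda_N$ be the eigenvalues of $\mathbf E^{-1}\mathbf A$ (assumed real and distinct). Let $1\le k\le N$ and $c>0$ be such that $\lambda_i\le -c$ for $i<k$ and $\lambda_i\ge c$ for $i>k$ on $\mathcal U$, and let $\mathbf u^*\in\mathcal U$ with $\lambda_k(\mathbf u^*)=0$. Let $\mathbf r_k$ be a field of class $C^2$ of eigenvectors for $\lambda_k$, and assume that the $k$-th field is genuinely nonlinear: $\nabla\lambda_k\cdot\mathbf r_k\ge d>0$ on $\mathcal U$. Boundary layers. The equation $\mathbf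 A(\mathbf u)\mathbf u'=\mathbf B(\mathbf u)\mathbf u''+\mathbf G(\mathbf u,\mathbf u')\mathbf u'$ is equivalent to an autonomous first order system for $(\mathbf u,\mathbf z_2)=(\mathbf u,\mathbf u_2')\in\mathbb R^{N+m}$. Fix a center manifold of this system at $(\mathbf u^*,\mathbf 0)$, given as $\{(\mathbf u,z_c\mathbf p_c(\mathbf u,z_c))\}$ for $(\mathbf u,z_c)$ in a neighborhood of $(\mathbf u^*,0)$, where $\mathbf p_c$ is of class $C^3$ with values in $\mathbb R^{m}$, $\mathbf p_c^t\mathbf B_{22}\mathbf p_c\equiv1$, and $\mathbf p_c(\mathbf u^*,0)$ is a nonzero vector in the kernel of $[\mathbf A_{22}-\mathbf A_{21}\mathbf A_{11}^{-1}\mathbf A_{21}^t](\mathbf u^*)$. Set $\mathbf r_c=(-\mathbf A_{11}^{-1}\mathbf A_{21}^t\mathbf p_c,\mathbf p_c)$, and let $\theta_c(\mathbf u,z_c)$ be the scalar function such that the system on the center manifold reads $\mathbf u'=z_c\mathbf r_c$, $z_c'=z_c\theta_c$. The eigenvectors are normalized so that $\mathbf r_k(\mathbf u)=\mathbf r_c(\mathbf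 u,0)$ whenever $\lambda_k(\mathbf u)=0$. Let $(\mathbf u,z_c)$ solve $d\mathbf u/d\tau=\mathbf r_c(\mathbf u,z_c)$, $dz_c/d\tau=\theta_c(\mathbf u,z_c)$, $\mathbf u(0)=\widetilde{\mathbf u}$, $z_c(0)=0$, and set $\mathbf b_k(\widetilde{\mathbf u},s)=(\mathbf u,z_c\mathbf p_c(\mathbf u,z_c))(\tau=s)$. Lax curve. Let $\mathbf i_k(\widetilde{\mathbf u},\cdot)$ be the integral curve of $\mathbf r_k$ through $\widetilde{\mathbf u}$. Let $\mathbf h_k(\widetilde{\mathbf u},\cdot)$ be the Hugoniot curve of the $k$-th family with shock speed $\sigma_k$, i.e. $\mathbf f(\mathbf v(\mathbf h_k))-\mathbf f(\mathbf v(\widetilde{\mathbf u}))=\sigma_k[\mathbf g(\mathbf v(\mathbf h_k))-\mathbf g(\mathbf v(\widetilde{\mathbf u}))]$, where $\mathbf h_k,\sigma_k$ are of class $C^2$ in $(\widetilde{\mathbf u},s)$ near $(\mathbf u^*,0)$, $\mathbf h_k(\widetilde{\mathbf u},0)=\widetilde{\mathbf u}$, $\partial_s\mathbf h_k(\widetilde{\mathbf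 u},0)=\mathbf r_k(\widetilde{\mathbf u})$, $\sigma_k(\widetilde{\mathbf u},0)=\lambda_k(\widetilde{\mathbf u})$, and the parameter $s$ is chosen so that, for $(\widetilde{\mathbf u},s)$ near $(\mathbf u^*,0)$ with $\lambda_k(\widetilde{\mathbf u})<0$ and $s>0$, one has $\sigma_k(\widetilde{\mathbf u},s)=0$ if and only if $z_c(\tau=s)=0$. Set $\mathbf t_k(\widetilde{\mathbf u},s)=\mathbf i_k(\widetilde{\mathbf u},s)$ for $s\le0$ and $\mathbf t_k(\widetilde{\mathbf u},s)=\mathbf h_k(\widetilde{\mathbf u},s)$ for $s>0$; set $\varsigma_k(\widetilde{\mathbf u},s)=\sigma_k(\widetilde{\mathbf u},s)$ for $s\ge0$ and $\varsigma_k(\widetilde{\mathbf u},s)=\lambda_k(\mathbf t_k(\widetilde{\mathbf u},s))$ for $s<0$. Lemma. There are constants $C,\rho,\nu>0$ such that the following holds for every $\widetilde{\mathbf u}$ with $|\widetilde{\mathbf u}-\mathbf u^*|\le\nu$. There are a unique $\underline s=\underline s(\widetilde{\mathbf u})\in\,]-\rho,\rho[$ with $\sigma_k(\widetilde{\mathbf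 u},\underline s)=0$ and a unique $\bar s=\bar s(\widetilde{\mathbf u})\in\,]-\rho,\rho[$ with $\lambda_k(\mathbf i_k(\widetilde{\mathbf u},\bar s))=0$. Moreover, if $$\boldsymbol\gamma_k(\widetilde{\mathbf u},s)=\begin{cases}\mathbf b_k(\widetilde{\mathbf u},s)&\text{if }\lambda_k(\widetilde{\mathbf u})<0,\ s<\underline s,\\ \mathbf b_k(\mathbf t_k(\widetilde{\mathbf u},\bar s),s-\bar s)&\text{if }\lambda_k(\widetilde{\mathbf u})\ge0,\ s<\bar s,\\ (\mathbf t_k(\widetilde{\mathbf u},s),\mathbf 0_{m})&\text{otherwise,}\end{cases}$$ then for every $s\in\,]-\nu,\nu[$ $$\big|(\mathbf t_k(\widetilde{\mathbf u},s),\mathbf 0_{m})-\boldsymbol\gamma_k(\widetilde{\mathbf u},s)\big|\le C\,|s|\,[\varsigma_k(\widetilde{\mathbf u},s)]^-,$$ where $[x]^-=\max\{-x,0\}$. The constants do not depend on $\widetilde{\mathbf u}$ and $s$. -/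

import Mathlib

open Set Filter Topology
open scoped Matrix ContDiff

noncomputable section

/-- The state space `ℝ^N`, `N = h + m`, split as `u = (u₁, u₂)` with `u₁ ∈ ℝ^h`, `u₂ ∈ ℝ^m`. -/
abbrev State (h m : ℕ) := EuclideanSpace ℝ (Fin h ⊕ Fin m)

/-- The space `ℝ^m = ℝ^(N-h)` of the parabolic components. -/
abbrev Par (m : ℕ) := EuclideanSpace ℝ (Fin m)

/-- The last `m` components of a state. -/
def parPart {h m : ℕ} (u : State h m) : Par m := WithLp.toLp 2 fun j => u (Sum.inr j)

/-- The first `h` components of a state. -/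
def hypPart {h m : ℕ} (u : State h m) : Fin h → ℝ := fun i => u (Sum.inl i)

/-- The state with the given first `h` and last `m` components. -/
def joinState {h m : ℕ} (x : Fin h → ℝ) (y : Par m) : State h m :=
  WithLp.toLp 2 (Sum.elim x fun j => y j)

/-- The data of a mixed hyperbolic-parabolic system. In the conservative variable it is
`g(v)_t + f(v)_x = (D(v) v_x)_x` on `V`; after the change of variables `u ↦ v(u)` from `U` to `V`
it is `E(u) u_t + A(u) u_x = B(u) u_xx + G(u, u_x) u_x`, where `G` has vanishing first `h` rows
and last `m` rows `(G₁, G₂)`; `G₁` depends on `u` and on the last `m` components of `u_x`. -/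
structure ViscousSystem (h m : ℕ) where
  U : Set (State h m)
  V : Set (State h m)
  g : State h m → State h m
  f : State h m → State h m
  D : State h m → (State h m →L[ℝ] State h m)
  v : State h m → State h m
  E : State h m → Matrix (Fin h ⊕ Fin m) (Fin h ⊕ Fin m) ℝ
  A : State h m → Matrix (Fin h ⊕ Fin m) (Fin h ⊕ Fin m) ℝ
  B : State h m → Matrix (Fin h ⊕ Fin m) (Fin h ⊕ Fin m) ℝ
  G₁ : State h m → Par m → Matrix (Fin m) (Fin h) ℝ
  G₂ : State h m → State h m → Matrix (Fin m) (Fin m) ℝ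

namespace ViscousSystem

variable {h m : ℕ} (S : ViscousSystem h m)

def A11 (u : State h m) : Matrix (Fin h) (Fin h) ℝ := (S.A u).toBlocks₁₁
def A21 (u : State h m) : Matrix (Fin m) (Fin h) ℝ := (S.A u).toBlocks₂₁
def A22 (u : State h m) : Matrix (Fin m) (Fin m) ℝ := (S.A u).toBlocks₂₂
def B22 (u : State h m) : Matrix (Fin m) (Fin m) ℝ := (S.B u).toBlocks₂₂

/-- The vector `G(u, q) q`. -/
def gTerm (u q : State h m) : State h m :=
  joinState 0 (WithLp.toLp 2 (S.G₁ u (parPart q) *ᵥ hypPart q + S.G₂ u q *ᵥ (parPart q)))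

/-- The viscosity in the variable `u`: `D(v) v_x = (D(v(u)) Dv(u)) u_x`. -/
def visc (u : State h m) : State h m →L[ℝ] State h m := (S.D (S.v u)).comp (fderiv ℝ S.v u)

/-- The system is smooth and in normal form. -/
structure IsNormalForm : Prop where
  isOpen_U : IsOpen S.U
  isOpen_V : IsOpen S.V
  smooth_g : ContDiffOn ℝ ∞ S.g S.V
  smooth_f : ContDiffOn ℝ ∞ S.f S.V
  smooth_D : ContDiffOn ℝ ∞ S.D S.V
  smooth_v : ContDiffOn ℝ ∞ S.v S.U
  bijOn_v : BijOn S.v S.U S.V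
  smooth_E : ∀ i j, ContDiffOn ℝ ∞ (fun u => S.E u i j) S.U
  smooth_A : ∀ i j, ContDiffOn ℝ ∞ (fun u => S.A u i j) S.U
  smooth_B : ∀ i j, ContDiffOn ℝ ∞ (fun u => S.B u i j) S.U
  smooth_G₁ : ∀ i j, ContDiffOn ℝ ∞
    (fun w : State h m × Par m => S.G₁ w.1 w.2 i j) (S.U ×ˢ univ)
  smooth_G₂ : ∀ i j, ContDiffOn ℝ ∞
    (fun w : State h m × State h m => S.G₂ w.1 w.2 i j) (S.U ×ˢ univ)
  /-- Inserting `v = v(u)` in the conservative system, expanding the derivatives and multiplying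
  on the left by an invertible matrix `M(u)` gives the system in the variable `u`. -/
  rewriting : ∀ u ∈ S.U, ∃ M : State h m ≃L[ℝ] State h m,
    (∀ x, M (fderiv ℝ (S.g ∘ S.v) u x) = WithLp.toLp 2 (S.E u *ᵥ x)) ∧
    (∀ x, M (fderiv ℝ (S.f ∘ S.v) u x) = WithLp.toLp 2 (S.A u *ᵥ x)) ∧
    (∀ x, M (S.visc u x) = WithLp.toLp 2 (S.B u *ᵥ x)) ∧
    (∀ q, M (fderiv ℝ S.visc u q q) = S.gTerm u q)
  B_block : ∀ u ∈ S.U,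
    (S.B u).toBlocks₁₁ = 0 ∧ (S.B u).toBlocks₁₂ = 0 ∧ (S.B u).toBlocks₂₁ = 0
  B22_posDef : ∀ u ∈ S.U, (S.B22 u).PosDef
  A_symm : ∀ u ∈ S.U, (S.A u).IsSymm
  E_posDef : ∀ u ∈ S.U, (S.E u).PosDef
  E_block : ∀ u ∈ S.U, (S.E u).toBlocks₁₂ = 0 ∧ (S.E u).toBlocks₂₁ = 0
  G₁_zero : ∀ u ∈ S.U, S.G₁ u 0 = 0
  G₂_zero : ∀ u ∈ S.U, S.G₂ u 0 = 0

/-- The Kawashima-Shizuta condition: no eigenvector of `E⁻¹ A` lies in the kernel of `B`. -/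
def KawashimaShizuta : Prop :=
  ∀ u ∈ S.U, ∀ (μ : ℝ) (x : Fin h ⊕ Fin m → ℝ),
    Module.End.HasEigenvector (Matrix.toLin' ((S.E u)⁻¹ * S.A u)) μ x → S.B u *ᵥ x ≠ 0

/-- `lam 0 u < ⋯ < lam (N-1) u` are the eigenvalues of `E⁻¹ A (u)` for `u ∈ U`; they all are
bounded away from `0`, except for the `k`-th one, which vanishes at `ustar ∈ U`. -/
structure BoundaryCharacteristic (lam : Fin (h + m) → State h m → ℝ) (k : Fin (h + m))
    (ustar : State h m) : Prop where
  eigenvalue : ∀ u ∈ S.U, ∀ i,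
    Module.End.HasEigenvalue (Matrix.toLin' ((S.E u)⁻¹ * S.A u)) (lam i u)
  strictMono : ∀ u ∈ S.U, StrictMono fun i => lam i u
  gap : ∃ c : ℝ, 0 < c ∧ ∀ u ∈ S.U,
    (∀ i, i < k → lam i u ≤ -c) ∧ (∀ i, k < i → c ≤ lam i u)
  mem_U : ustar ∈ S.U
  vanish : lam k ustar = 0

/-- `r` is a regular field of eigenvectors for the eigenvalue `lamk` of `E⁻¹ A`, and the field is
genuinely nonlinear. -/
structure GenuinelyNonlinear (lamk : State h m → ℝ) (r : State h m → State h m) : Prop where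
  regular : ContDiffOn ℝ 2 r S.U
  eigenvector : ∀ u ∈ S.U,
    Module.End.HasEigenvector (Matrix.toLin' ((S.E u)⁻¹ * S.A u)) (lamk u) (r u).ofLp
  gnl : ∃ d : ℝ, 0 < d ∧ ∀ u ∈ S.U,
    DifferentiableAt ℝ lamk u ∧ d ≤ fderiv ℝ lamk u (r u)

/-! ### Boundary layers -/

/-- The vector `(-A₁₁⁻¹ A₂₁ᵗ y, y)`. On steady solutions, `u' = lift u z₂` with `z₂ = u₂'`. -/
def lift (u : State h m) (y : Par m) : State h m :=
  joinState (-((S.A11 u)⁻¹ *ᵥ ((S.A21 u)ᵀ *ᵥ y))) y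

/-- The matrix `(G₁ - A₂₁) A₁₁⁻¹ A₂₁ᵗ + A₂₂ - G₂` at `u`, with `u_x = q`. -/
def blMatrix (u q : State h m) : Matrix (Fin m) (Fin m) ℝ :=
  (S.G₁ u (parPart q) - S.A21 u) * (S.A11 u)⁻¹ * (S.A21 u)ᵀ + S.A22 u - S.G₂ u q

/-- The vector field of the first order system, in the unknown `(u, z₂)`, that is equivalent to
`A(u) u' = B(u) u'' + G(u, u') u'`. -/
def blField (w : State h m × Par m) : State h m × Par m :=
  (S.lift w.1 w.2,
    WithLp.toLp 2 ((S.B22 w.1)⁻¹ *ᵥ (S.blMatrix w.1 (S.lift w.1 w.2) *ᵥ w.2)))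

/-- The set `{(u, z p(u, z)) : (u, z) ∈ W}`. -/
def centerSet (W : Set (State h m × ℝ)) (p : State h m × ℝ → Par m) : Set (State h m × Par m) :=
  (fun w => (w.1, w.2 • p w)) '' W

/-- `p` parametrizes a center manifold of the boundary layer system at `(ustar, 0)`: the
`(N+1)`-dimensional set `{(u, z p(u, z))}` is locally invariant, and its tangent space at
`(ustar, 0)` is the center space `ℝ^N × span p(ustar, 0)`, because `p(ustar, 0)` spans the kernel
of `A₂₂ - A₂₁ A₁₁⁻¹ A₂₁ᵗ` at `ustar`. -/
structure IsCenterManifold (ustar : State h m) (W : Set (State h m × ℝ))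
    (p : State h m × ℝ → Par m) : Prop where
  isOpen : IsOpen W
  base_mem : (ustar, (0 : ℝ)) ∈ W
  fst_mem : ∀ w ∈ W, w.1 ∈ S.U
  regular : ContDiffOn ℝ 3 p W
  ne_zero : p (ustar, 0) ≠ 0
  kernel : (S.A22 ustar - S.A21 ustar * (S.A11 ustar)⁻¹ * (S.A21 ustar)ᵀ) *ᵥ p (ustar, 0) = 0
  normalized : ∀ w ∈ W, (p w).ofLp ⬝ᵥ (S.B22 w.1 *ᵥ p w) = 1
  invariant : ∀ w₀ ∈ centerSet W p, ∃ ε : ℝ, 0 < ε ∧ ∃ w : ℝ → State h m × Par m,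
    w 0 = w₀ ∧ ∀ x ∈ Ioo (-ε) ε, w x ∈ centerSet W p ∧ HasDerivAt w (S.blField (w x)) x

/-- The vector `r_c(u, z)`. -/
def rc (p : State h m × ℝ → Par m) (w : State h m × ℝ) : State h m := S.lift w.1 (p w)

/-- The function `θ_c(u, z)`: on the center manifold the boundary layer system reads
`u' = z r_c(u, z)`, `z' = z θ_c(u, z)`. -/
def thetac (p : State h m × ℝ → Par m) (w : State h m × ℝ) : ℝ :=
  ((p w).ofLp ⬝ᵥ (S.blMatrix w.1 (w.2 • S.rc p w) *ᵥ p w)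
      - w.2 * ((p w).ofLp ⬝ᵥ (S.B22 w.1 *ᵥ (fderiv ℝ p w (S.rc p w, 0)))))
    / (1 + w.2 * ((p w).ofLp ⬝ᵥ (S.B22 w.1 *ᵥ (fderiv ℝ p w (0, 1)))))

end ViscousSystem

/-! ### The curves -/

/-- For every `x` close to `x₀`, `φ x` solves `φ' = X(φ)`, `φ(0) = init x` on a fixed
neighbourhood of `0`, with values in the open set `W` on which the vector field `X` is given. -/
def SolvesCauchyNear {F₀ F : Type*} [NormedAddCommGroup F₀] [NormedAddCommGroup F]
    [NormedSpace ℝ F] (X : F → F) (W : Set F) (init : F₀ → F) (x₀ : F₀) (φ : F₀ → ℝ → F) : Prop :=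
  ∃ ρ : ℝ, 0 < ρ ∧ ∀ x ∈ Metric.ball x₀ ρ, φ x 0 = init x ∧
    ∀ s ∈ Ioo (-ρ) ρ, φ x s ∈ W ∧ HasDerivAt (φ x) (X (φ x s)) s

namespace ViscousSystem

variable {h m : ℕ} (S : ViscousSystem h m)

/-- `i u ·` is the rarefaction curve through `u`, for `u` close to `ustar`. -/
def IsRarefactionCurve (ustar : State h m) (r : State h m → State h m)
    (i : State h m → ℝ → State h m) : Prop :=
  SolvesCauchyNear r S.U id ustar i

/-- `y u ·` is the solution `(u, z_c)` of `du/dτ = r_c(u, z_c)`, `dz_c/dτ = θ_c(u, z_c)` that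
starts at `(u, 0)`, for `u` close to `ustar`. -/
def IsLayerCurve (ustar : State h m) (W : Set (State h m × ℝ)) (p : State h m × ℝ → Par m)
    (y : State h m → ℝ → State h m × ℝ) : Prop :=
  SolvesCauchyNear (fun w => (S.rc p w, S.thetac p w)) W (fun u => (u, 0)) ustar y

/-- `H u ·` is the Hugoniot curve of the `k`-th family through `u` and `σ u ·` the corresponding
shock speed, for `u` close to `ustar`. -/
def IsHugoniotCurve (ustar : State h m) (lamk : State h m → ℝ) (r : State h m → State h m)
    (H : State h m → ℝ → State h m) (σ : State h m → ℝ → ℝ) : Prop :=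
  ∃ ρ : ℝ, 0 < ρ ∧
    ContDiffOn ℝ 2 (fun q : State h m × ℝ => H q.1 q.2) (Metric.ball ustar ρ ×ˢ Ioo (-ρ) ρ) ∧
    ContDiffOn ℝ 2 (fun q : State h m × ℝ => σ q.1 q.2) (Metric.ball ustar ρ ×ˢ Ioo (-ρ) ρ) ∧
    ∀ u ∈ Metric.ball ustar ρ,
      H u 0 = u ∧ HasDerivAt (H u) (r u) 0 ∧ σ u 0 = lamk u ∧
      ∀ s ∈ Ioo (-ρ) ρ, H u s ∈ S.U ∧
        S.f (S.v (H u s)) - S.f (S.v u) = σ u s • (S.g (S.v (H u s)) - S.g (S.v u))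

end ViscousSystem

variable {h m : ℕ}

/-- The wave fan curve `t_k` of admissible (left) states. -/
def laxCurve (i H : State h m → ℝ → State h m) (u : State h m) (s : ℝ) : State h m :=
  if s ≤ 0 then i u s else H u s

/-- The speed `ς_k`. -/
def waveSpeed (lamk : State h m → ℝ) (i H : State h m → ℝ → State h m)
    (σ : State h m → ℝ → ℝ) (u : State h m) (s : ℝ) : ℝ :=
  if 0 ≤ s then σ u s else lamk (laxCurve i H u s)

/-- The boundary layer curve `b_k(u, s) = (u(s), z_c(s) p_c(u(s), z_c(s)))`. -/
def layerCurve (p : State h m × ℝ → Par m) (y : State h m → ℝ → State h m × ℝ)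
    (u : State h m) (s : ℝ) : State h m × Par m :=
  ((y u s).1, (y u s).2 • p (y u s))

open Classical in
/-- A zero of `φ` in the interval `]-ρ, ρ[` (to be used when there is exactly one). -/
def zeroIn (ρ : ℝ) (φ : ℝ → ℝ) : ℝ :=
  if hz : ∃ s, s ∈ Ioo (-ρ) ρ ∧ φ s = 0 then hz.choose else 0

/-- The value at which the shock speed vanishes. -/
def sUnder (ρ : ℝ) (σ : State h m → ℝ → ℝ) (u : State h m) : ℝ := zeroIn ρ (σ u)

/-- The value at which the `k`-th eigenvalue vanishes along the rarefaction curve. -/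
def sBar (ρ : ℝ) (lamk : State h m → ℝ) (i : State h m → ℝ → State h m) (u : State h m) : ℝ :=
  zeroIn ρ fun s => lamk (i u s)

open Classical in
/-- The curve `γ_k` (genuinely nonlinear case). -/
def gammaCurve (ρ : ℝ) (lamk : State h m → ℝ) (i H : State h m → ℝ → State h m)
    (σ : State h m → ℝ → ℝ) (p : State h m × ℝ → Par m) (y : State h m → ℝ → State h m × ℝ)
    (u : State h m) (s : ℝ) : State h m × Par m :=
  if lamk u < 0 then
    if s < sUnder ρ σ u then layerCurve p y u s else (laxCurve i H u s, 0)
  else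
    if s < sBar ρ lamk i u then
      layerCurve p y (laxCurve i H u (sBar ρ lamk i u)) (s - sBar ρ lamk i u)
    else (laxCurve i H u s, 0)

end

/-! ### Curves with controlled derivative -/

/-! The curves `t_k` and `γ_k` differ only where the speed `ς_k` is negative, and there the distance
is compared with the speed in three regimes. Both `σ_k(u, ·)` and `λ_k` along the rarefaction curve
increase at a rate at least `c > 0`, which gives the unique zeros and bounds `-ς_k` from below.

If `λ_k(u) ≥ 0`, the layer starts at the rarefaction state with `λ_k = 0`. There the fields `(r_k,
0)` and `(r_c, θ_c)` coincide, so the curves are tangent and separate by `O(|s - s̄|²)`, while `-λ_k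
≥ c |s - s̄|`. If `λ_k(u) < 0` and `s < 0`, the fields differ at `(u, 0)` by `O(|λ_k(u)|)`, so the
distance is `O((|λ_k(u)| + |s|) |s|)`, and `-λ_k` at the endpoint dominates `|λ_k(u)| + c |s|`. If
`λ_k(u) < 0` and `0 < s < s̲`, the Hugoniot and layer curves meet both at `0` and at `s̲`; a
difference with Lipschitz derivative and two zeros is `O(s (s̲ - s))` (`norm_le_mul_of_two_zeros`),
while `-σ_k ≥ c (s̲ - s)`. `exists_norm_sub_gammaCurve_le` carries out these estimates.

The meeting at `s̲` is the conceptual point (`ViscousSystem.layer_eq_hugoniot`). The Hugoniot state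
has the flux `f` of `u` because the shock speed is zero. The layer state has it too, because `f - D
v_x` is conserved along layers (`hasFDerivAt_totalFlux`) and `z_c = 0` at both ends. By genuine
nonlinearity the flux folds near `u*`, so no three distinct nearby states share a flux
(`exists_ball_flux_fold`), and the two states coincide. Monotonicity of `σ_k` comes from the
classical identity `2 ∂_s σ_k = ∇λ_k · r_k` (`two_mul_deriv_shockSpeed`). -/

theorem norm_sub_lt_of_hasDerivAt {F : Type*} [NormedAddCommGroup F] [NormedSpace ℝ F]
    {X : F → F} {x₀ : F} {δ K ρ : ℝ} {φ : ℝ → F} (hK : ∀ x ∈ Metric.ball x₀ δ, ‖X x‖ ≤ K)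
    (hφ : ∀ s ∈ Ico 0 ρ, HasDerivAt φ (X (φ s)) s) (h0 : ‖φ 0 - x₀‖ < δ / 2) {s : ℝ}
    (hs0 : 0 ≤ s) (hs : s < ρ) (hsδ : (K + 1) * s < δ / 2) : ‖φ s - x₀‖ < δ := by
  have hK0 : 0 ≤ K := by
    refine (norm_nonneg _).trans (hK x₀ (Metric.mem_ball_self ?_))
    linarith [norm_nonneg (φ 0 - x₀)]
  have hd : ∀ t ∈ Icc 0 s, HasDerivAt (fun t => φ t - x₀) (X (φ t)) t := fun t ht =>
    (hφ t ⟨ht.1, ht.2.trans_lt hs⟩).sub_const x₀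
  -- The bound `K` holds only inside the ball that the curve must not leave. The barrier `δ / 2 + (K
  -- + 1) t` needs it only at times of contact, when the curve is still inside; the slope `K + 1`
  -- makes the comparison strict.
  have key := image_norm_le_of_norm_deriv_right_lt_deriv_boundary
    (f := fun t => φ t - x₀) (f' := fun t => X (φ t)) (a := 0) (b := s)
    (B := fun t => δ / 2 + (K + 1) * t) (B' := fun _ => K + 1)
    (fun t ht => (hd t ht).continuousAt.continuousWithinAt)
    (fun t ht => (hd t ⟨ht.1, ht.2.le⟩).hasDerivWithinAt)
    (by simpa using h0.le)
    (fun t => by simpa using ((hasDerivAt_id t).const_mul (K + 1)).const_add (δ / 2))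
    (fun t ht hB => by
      have h1 : (K + 1) * t ≤ (K + 1) * s := by gcongr; exact ht.2.le
      have : ‖φ t - x₀‖ < δ := by rw [hB]; linarith
      linarith [hK (φ t) (by rwa [mem_ball_iff_norm])])
    (right_mem_Icc.2 hs0)
  exact key.trans_lt (by linarith)

theorem norm_sub_lt_of_hasDerivAt_abs {F : Type*} [NormedAddCommGroup F] [NormedSpace ℝ F]
    {X : F → F} {x₀ : F} {δ K ρ : ℝ} {φ : ℝ → F} (hK : ∀ x ∈ Metric.ball x₀ δ, ‖X x‖ ≤ K)
    (hφ : ∀ s ∈ Ioo (-ρ) ρ, HasDerivAt φ (X (φ s)) s) (h0 : ‖φ 0 - x₀‖ < δ / 2) {s : ℝ}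
    (hs : |s| < ρ) (hsδ : (K + 1) * |s| < δ / 2) : ‖φ s - x₀‖ < δ := by
  have hρ : 0 < ρ := (abs_nonneg s).trans_lt hs
  rcases le_total 0 s with h | h
  · rw [abs_of_nonneg h] at hs hsδ
    exact norm_sub_lt_of_hasDerivAt hK (fun t ht => hφ t ⟨by linarith [ht.1], ht.2⟩) h0 h hs hsδ
  · rw [abs_of_nonpos h] at hs hsδ
    have := norm_sub_lt_of_hasDerivAt (X := fun x => -X x) (φ := fun t => φ (-t)) (s := -s)
      (ρ := ρ) (x₀ := x₀) (δ := δ) (K := K) (fun x hx => by simpa using hK x hx)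
      (fun t ht => by
        have := (hφ (-t) ⟨by linarith [ht.2], by linarith [ht.1]⟩).scomp t (hasDerivAt_neg t)
        rw [neg_one_smul] at this
        exact this)
      (by simpa using h0) (by linarith) hs hsδ
    simpa using this

theorem norm_image_sub_le_of_hasDerivAt {F : Type*} [NormedAddCommGroup F] [NormedSpace ℝ F]
    {φ φ' : ℝ → F} {K : ℝ} {J : Set ℝ} (hJ : Convex ℝ J)
    (hφ : ∀ s ∈ J, HasDerivAt φ (φ' s) s) (hK : ∀ s ∈ J, ‖φ' s‖ ≤ K) {s t : ℝ} (hs : s ∈ J)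
    (ht : t ∈ J) : ‖φ s - φ t‖ ≤ K * |s - t| := by
  simpa using hJ.norm_image_sub_le_of_norm_hasDerivWithin_le
    (fun x hx => (hφ x hx).hasDerivWithinAt) hK ht hs

theorem ContinuousAt.exists_norm_le {E F : Type*} [NormedAddCommGroup E] [NormedAddCommGroup F]
    {X : E → F} {x₀ : E} (hX : ContinuousAt X x₀) :
    ∃ K : ℝ, 0 ≤ K ∧ ∀ᶠ x in 𝓝 x₀, ‖X x‖ ≤ K := by
  refine ⟨‖X x₀‖ + 1, by positivity, ?_⟩
  exact (hX.norm.eventually (gt_mem_nhds (lt_add_one _))).mono fun x hx => hx.le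

/-- `SolvesCauchyNear` places the trajectories only in `W`. A field continuous at `init x₀` is
bounded nearby, so nearby trajectories remain in any prescribed ball for a common time; no
continuity of `φ` in the initial point is needed. -/
theorem SolvesCauchyNear.exists_uniform {F₀ F : Type*} [NormedAddCommGroup F₀]
    [NormedAddCommGroup F] [NormedSpace ℝ F] {X : F → F} {W : Set F} {init : F₀ → F} {x₀ : F₀}
    {φ : F₀ → ℝ → F} (hφ : SolvesCauchyNear X W init x₀ φ) (hinit : ContinuousAt init x₀)
    (hX : ContinuousAt X (init x₀)) {δ : ℝ} (hδ : 0 < δ) :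
    ∃ η : ℝ, 0 < η ∧ ∀ x ∈ Metric.ball x₀ η, φ x 0 = init x ∧
      ∀ s ∈ Ioo (-η) η, φ x s ∈ Metric.ball (init x₀) δ ∧ HasDerivAt (φ x) (X (φ x s)) s := by
  obtain ⟨ρ, hρ, hsol⟩ := hφ
  obtain ⟨K, hK0, hK⟩ := hX.exists_norm_le
  obtain ⟨δ₁, hδ₁, hK⟩ := Metric.eventually_nhds_iff_ball.1 hK
  set δ₂ := min δ δ₁
  have hδ₂ : 0 < δ₂ := lt_min hδ hδ₁
  obtain ⟨η₁, hη₁, hin⟩ := Metric.eventually_nhds_iff_ball.1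
    (hinit.eventually (Metric.ball_mem_nhds _ (half_pos hδ₂)))
  refine ⟨min (min ρ η₁) (δ₂ / 2 / (K + 1)), by positivity, fun x hx => ?_⟩
  have hx1 : x ∈ Metric.ball x₀ ρ :=
    Metric.ball_subset_ball ((min_le_left _ _).trans (min_le_left _ _)) hx
  have hx2 : x ∈ Metric.ball x₀ η₁ :=
    Metric.ball_subset_ball ((min_le_left _ _).trans (min_le_right _ _)) hx
  refine ⟨(hsol x hx1).1, fun s hs => ?_⟩
  have hs' : |s| < min (min ρ η₁) (δ₂ / 2 / (K + 1)) := abs_lt.2 hs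
  have hsρ : |s| < ρ := hs'.trans_le ((min_le_left _ _).trans (min_le_left _ _))
  have hsK : (K + 1) * |s| < δ₂ / 2 := by
    have := hs'.trans_le (min_le_right _ _)
    rwa [lt_div_iff₀ (by positivity), mul_comm] at this
  refine ⟨?_, ((hsol x hx1).2 s (abs_lt.1 hsρ)).2⟩
  have := norm_sub_lt_of_hasDerivAt_abs (X := X) (x₀ := init x₀) (δ := δ₂) (K := K) (ρ := ρ)
    (φ := φ x) (fun z hz => hK z (Metric.ball_subset_ball (min_le_right _ _) hz))
    (fun t ht => ((hsol x hx1).2 t ht).2)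
    (by rw [(hsol x hx1).1]; exact mem_ball_iff_norm.1 (hin x hx2)) hsρ hsK
  exact mem_ball_iff_norm.2 (this.trans_le (min_le_left _ _))

/-- Expand `D` to first order at `s` towards both zeros. In the combination with weights `a - s` and
`s` the terms in `D' s` cancel, and the remainders `L s²` and `L (a - s)²` add up to `a L s (a -
s)`. A Lipschitz derivative suffices. -/
theorem norm_le_mul_of_two_zeros {F : Type*} [NormedAddCommGroup F] [NormedSpace ℝ F]
    {D D' : ℝ → F} {a L : ℝ} (ha : 0 < a) (hD : ∀ t ∈ Icc 0 a, HasDerivAt D (D' t) t)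
    (hL : ∀ s ∈ Icc 0 a, ∀ t ∈ Icc 0 a, ‖D' s - D' t‖ ≤ L * |s - t|) (h0 : D 0 = 0)
    (h1 : D a = 0) {s : ℝ} (hs : s ∈ Icc 0 a) : ‖D s‖ ≤ L * s * (a - s) := by
  have hL0 : 0 ≤ L := by
    have := (norm_nonneg _).trans (hL a (right_mem_Icc.2 ha.le) 0 (left_mem_Icc.2 ha.le))
    rw [sub_zero, abs_of_pos ha] at this
    exact nonneg_of_mul_nonneg_left this ha
  have aux : ∀ x ∈ Icc 0 a, ∀ y ∈ Icc 0 a, x ≤ y → s ∈ Icc x y →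
      ‖D y - D x - (y - x) • D' s‖ ≤ L * (y - x) * (y - x) := by
    intro x hx y hy hxy hsxy
    have h2 : ∀ t ∈ Icc x y, HasDerivAt (fun t => D t - t • D' s) (D' t - D' s) t := fun t ht => by
      have := (hD t ⟨hx.1.trans ht.1, ht.2.trans hy.2⟩).sub
        ((hasDerivAt_id t).smul_const (D' s))
      rw [one_smul] at this
      exact this
    have h3 := norm_image_sub_le_of_hasDerivAt (convex_Icc x y) h2 (K := L * (y - x))
      (fun t ht => (hL t ⟨hx.1.trans ht.1, ht.2.trans hy.2⟩ s hs).trans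
        (mul_le_mul_of_nonneg_left (abs_le.2 ⟨by linarith [ht.1, hsxy.2], by
          linarith [ht.2, hsxy.1]⟩) hL0)) (right_mem_Icc.2 hxy) (left_mem_Icc.2 hxy)
    rw [abs_of_nonneg (sub_nonneg.2 hxy)] at h3
    convert h3 using 2
    rw [sub_smul]; abel
  have e1 := aux 0 (left_mem_Icc.2 ha.le) s hs hs.1 ⟨hs.1, le_rfl⟩
  have e2 := aux s hs a (right_mem_Icc.2 ha.le) hs.2 ⟨le_rfl, hs.2⟩
  rw [h0, sub_zero, sub_zero] at e1
  rw [h1] at e2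
  have e3 : a • D s = (a - s) • (D s - s • D' s) - s • (0 - D s - (a - s) • D' s) := by
    module
  have e4 : a * ‖D s‖ ≤ a * (L * s * (a - s)) := by
    calc a * ‖D s‖ = ‖a • D s‖ := by rw [norm_smul, Real.norm_of_nonneg ha.le]
      _ ≤ ‖(a - s) • (D s - s • D' s)‖ + ‖s • (0 - D s - (a - s) • D' s)‖ := by
        rw [e3]; exact norm_sub_le _ _
      _ ≤ (a - s) * (L * s * s) + s * (L * (a - s) * (a - s)) := by
        rw [norm_smul, norm_smul, Real.norm_of_nonneg (sub_nonneg.2 hs.2),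
          Real.norm_of_nonneg hs.1]
        have := sub_nonneg.2 hs.2
        have := hs.1
        gcongr
      _ = a * (L * s * (a - s)) := by ring
  exact le_of_mul_le_mul_left e4 ha

/-! ### Zeros of increasing functions -/

theorem mul_sub_le_of_hasDerivAt {φ φ' : ℝ → ℝ} {c : ℝ} {J : Set ℝ} (hJ : Convex ℝ J)
    (hφ : ∀ s ∈ J, HasDerivAt φ (φ' s) s) (hc : ∀ s ∈ J, c ≤ φ' s) {s t : ℝ} (hs : s ∈ J)
    (ht : t ∈ J) (hst : s ≤ t) : c * (t - s) ≤ φ t - φ s :=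
  hJ.mul_sub_le_image_sub_of_le_deriv
    (fun x hx => (hφ x hx).continuousAt.continuousWithinAt)
    (fun x hx => (hφ x (interior_subset hx)).differentiableAt.differentiableWithinAt)
    (fun x hx => by rw [(hφ x (interior_subset hx)).deriv]; exact hc x (interior_subset hx))
    s hs t ht hst

theorem existsUnique_zero_of_hasDerivAt {φ φ' : ℝ → ℝ} {c ρ : ℝ} (hc : 0 < c)
    (hφ : ∀ s ∈ Ioo (-ρ) ρ, HasDerivAt φ (φ' s) s) (hφc : ∀ s ∈ Ioo (-ρ) ρ, c ≤ φ' s)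
    (h0 : |φ 0| < c * ρ) : ∃! s, s ∈ Ioo (-ρ) ρ ∧ φ s = 0 := by
  obtain ⟨ρ', h1, h2⟩ := exists_between (show |φ 0| / c < ρ by rwa [div_lt_iff₀' hc])
  have hρ' : 0 ≤ ρ' := (by positivity : 0 ≤ |φ 0| / c).trans h1.le
  rw [div_lt_iff₀' hc, abs_lt] at h1
  have m0 : (0 : ℝ) ∈ Ioo (-ρ) ρ := ⟨by linarith, by linarith⟩
  have m1 : ρ' ∈ Ioo (-ρ) ρ := ⟨by linarith, by linarith⟩
  have m2 : -ρ' ∈ Ioo (-ρ) ρ := ⟨by linarith, by linarith⟩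
  have hmono := fun {s t : ℝ} => mul_sub_le_of_hasDerivAt (s := s) (t := t)
    (convex_Ioo (-ρ) ρ) hφ hφc
  have i1 := hmono m0 m1 hρ'
  have i2 := hmono m2 m0 (by linarith)
  have hcont : ContinuousOn φ (Icc (-ρ') ρ') := fun x hx =>
    (hφ x ⟨by linarith [hx.1], by linarith [hx.2]⟩).continuousAt.continuousWithinAt
  obtain ⟨s, hs, hs0⟩ := intermediate_value_Icc (by linarith : -ρ' ≤ ρ') hcont
    (show (0 : ℝ) ∈ Icc (φ (-ρ')) (φ ρ') from ⟨by linarith, by linarith⟩)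
  refine ⟨s, ⟨⟨by linarith [hs.1], by linarith [hs.2]⟩, hs0⟩, fun t ⟨ht, ht0⟩ => ?_⟩
  have hs' : s ∈ Ioo (-ρ) ρ := ⟨by linarith [hs.1], by linarith [hs.2]⟩
  rcases lt_trichotomy s t with h | h | h
  · have := hmono hs' ht h.le
    nlinarith [mul_pos hc (sub_pos.2 h)]
  · exact h.symm
  · have := hmono ht hs' h.le
    nlinarith [mul_pos hc (sub_pos.2 h)]

theorem zeroIn_spec {ρ : ℝ} {φ : ℝ → ℝ} (h : ∃ s, s ∈ Ioo (-ρ) ρ ∧ φ s = 0) :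
    zeroIn ρ φ ∈ Ioo (-ρ) ρ ∧ φ (zeroIn ρ φ) = 0 := by
  rw [zeroIn, dif_pos h]
  exact h.choose_spec

/-! ### Matrices with pairwise distinct eigenvalues -/

theorem exists_eq_smul_of_distinct_eigenvalues {n : ℕ} {M : Type*} [AddCommGroup M] [Module ℝ M]
    [FiniteDimensional ℝ M] (hn : Module.finrank ℝ M = n) {T : Module.End ℝ M} {l : Fin n → ℝ}
    (hl : Function.Injective l) {e : Fin n → M} (he : ∀ i, T.HasEigenvector (l i) (e i)) {x : M}
    {μ : ℝ} (hx : T x = μ • x) (hx0 : x ≠ 0) : ∃ i, μ = l i ∧ ∃ c : ℝ, x = c • e i := by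
  have hli : LinearIndependent ℝ e := Module.End.eigenvectors_linearIndependent' T l hl e he
  let b := basisOfLinearIndependentOfCardEqFinrank' e hli (by simp [hn])
  have hb : ∀ i, b i = e i := fun i => by simp [b]
  have hcoef : ∀ i, b.repr x i * (l i - μ) = 0 := by
    have h1 : ∑ i, (b.repr x i * (l i - μ)) • e i = 0 := by
      have h2 : T x - μ • x = ∑ i, (b.repr x i * (l i - μ)) • e i := by
        conv_lhs => rw [← b.sum_repr x]
        rw [map_sum, Finset.smul_sum, ← Finset.sum_sub_distrib]
        refine Finset.sum_congr rfl fun i _ => ?_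
        rw [map_smul, hb, (he i).apply_eq_smul]
        module
      rw [← h2, hx, sub_self]
    exact Fintype.linearIndependent_iff.1 hli _ h1
  have hex : ∃ i, b.repr x i ≠ 0 := by
    by_contra! hcon
    exact hx0 (by rw [← b.sum_repr x]; simp [hcon])
  obtain ⟨i, hi⟩ := hex
  have hμ : μ = l i := by
    have := (mul_eq_zero.1 (hcoef i)).resolve_left hi
    linarith
  refine ⟨i, hμ, b.repr x i, ?_⟩
  conv_lhs => rw [← b.sum_repr x]
  rw [Finset.sum_eq_single i, hb]
  · intro j _ hj
    have : l j - μ ≠ 0 := by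
      rw [hμ, sub_ne_zero]
      exact fun h => hj (hl h)
    rw [(mul_eq_zero.1 (hcoef j)).resolve_right this, zero_smul]
  · simp

/-! ### Entrywise regularity of matrices -/

section Entrywise

variable {E : Type*} [NormedAddCommGroup E] [NormedSpace ℝ E] {n : WithTop ℕ∞} {x₀ : E}
  {ι κ τ : Type*}

theorem contDiffAt_matrix_mul [Fintype κ] {P : E → Matrix ι κ ℝ} {Q : E → Matrix κ τ ℝ}
    (hP : ∀ i j, ContDiffAt ℝ n (fun x => P x i j) x₀)
    (hQ : ∀ i j, ContDiffAt ℝ n (fun x => Q x i j) x₀) (i : ι) (j : τ) :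
    ContDiffAt ℝ n (fun x => (P x * Q x) i j) x₀ := by
  simp only [Matrix.mul_apply]
  exact ContDiffAt.sum fun k _ => (hP i k).mul (hQ k j)

theorem contDiffAt_mulVec [Fintype κ] {P : E → Matrix ι κ ℝ} {q : E → κ → ℝ}
    (hP : ∀ i j, ContDiffAt ℝ n (fun x => P x i j) x₀)
    (hq : ∀ j, ContDiffAt ℝ n (fun x => q x j) x₀) (i : ι) :
    ContDiffAt ℝ n (fun x => (P x *ᵥ q x) i) x₀ := by
  simp only [Matrix.mulVec, dotProduct]
  exact ContDiffAt.sum fun k _ => (hP i k).mul (hq k)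

theorem contDiffAt_dotProduct [Fintype κ] {q q' : E → κ → ℝ}
    (hq : ∀ j, ContDiffAt ℝ n (fun x => q x j) x₀)
    (hq' : ∀ j, ContDiffAt ℝ n (fun x => q' x j) x₀) :
    ContDiffAt ℝ n (fun x => q x ⬝ᵥ q' x) x₀ := by
  simp only [dotProduct]
  exact ContDiffAt.sum fun k _ => (hq k).mul (hq' k)

theorem contDiffAt_det [Fintype κ] [DecidableEq κ] {P : E → Matrix κ κ ℝ}
    (hP : ∀ i j, ContDiffAt ℝ n (fun x => P x i j) x₀) :
    ContDiffAt ℝ n (fun x => (P x).det) x₀ := by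
  simp only [Matrix.det_apply']
  exact ContDiffAt.sum fun s _ => contDiffAt_const.mul (contDiffAt_prod fun i _ => hP _ _)

/-- By Cramer's rule the entries of the inverse are determinants divided by `det P`. -/
theorem contDiffAt_matrix_inv [Fintype κ] [DecidableEq κ] {P : E → Matrix κ κ ℝ}
    (hP : ∀ i j, ContDiffAt ℝ n (fun x => P x i j) x₀) (hdet : (P x₀).det ≠ 0) (i j : κ) :
    ContDiffAt ℝ n (fun x => (P x)⁻¹ i j) x₀ := by
  simp only [Matrix.inv_def, Ring.inverse_eq_inv', Matrix.smul_apply, smul_eq_mul,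
    Matrix.adjugate_apply]
  refine ((contDiffAt_det hP).inv hdet).mul (contDiffAt_det fun k l => ?_)
  simp only [Matrix.updateRow_apply]
  split_ifs
  · exact contDiffAt_const
  · exact hP k l

theorem contDiffAt_toLp [Fintype κ] {q : E → κ → ℝ}
    (hq : ∀ j, ContDiffAt ℝ n (fun x => q x j) x₀) :
    ContDiffAt ℝ n (fun x => (WithLp.toLp 2 (q x) : EuclideanSpace ℝ κ)) x₀ :=
  (contDiffAt_piLp 2).2 hq

theorem contDiffAt_coord [Fintype κ] {q : E → EuclideanSpace ℝ κ} (hq : ContDiffAt ℝ n q x₀)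
    (j : κ) : ContDiffAt ℝ n (fun x => q x j) x₀ :=
  (contDiffAt_piLp 2).1 hq j

end Entrywise

theorem contDiffAt_joinState {E : Type*} [NormedAddCommGroup E] [NormedSpace ℝ E]
    {n : WithTop ℕ∞} {x₀ : E} {h m : ℕ} {q : E → Fin h → ℝ} {q' : E → Par m}
    (hq : ∀ j, ContDiffAt ℝ n (fun x => q x j) x₀) (hq' : ContDiffAt ℝ n q' x₀) :
    ContDiffAt ℝ n (fun x => joinState (q x) (q' x)) x₀ := by
  refine contDiffAt_toLp fun j => ?_
  cases j with
  | inl j => exact hq j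
  | inr j => exact contDiffAt_coord hq' j

namespace ViscousSystem

variable {h m : ℕ} {S : ViscousSystem h m}

/-! ### The normal form at a point -/

theorem IsNormalForm.contDiffAt_entry (hS : S.IsNormalForm)
    {P : State h m → Matrix (Fin h ⊕ Fin m) (Fin h ⊕ Fin m) ℝ}
    (hP : ∀ i j, ContDiffOn ℝ ∞ (fun u => P u i j) S.U) {u : State h m} (hu : u ∈ S.U) (i j) :
    ContDiffAt ℝ ∞ (fun u => P u i j) u :=
  (hP i j).contDiffAt (hS.isOpen_U.mem_nhds hu)

theorem IsNormalForm.isUnit_det_E (hS : S.IsNormalForm) {u : State h m} (hu : u ∈ S.U) :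
    IsUnit (S.E u).det :=
  (Matrix.isUnit_iff_isUnit_det _).1 (hS.E_posDef u hu).isUnit

theorem IsNormalForm.mulVec_eq_of_hasEigenvector (hS : S.IsNormalForm) {u : State h m}
    (hu : u ∈ S.U) {μ : ℝ} {x : Fin h ⊕ Fin m → ℝ}
    (hx : Module.End.HasEigenvector (Matrix.toLin' ((S.E u)⁻¹ * S.A u)) μ x) :
    S.A u *ᵥ x = μ • (S.E u *ᵥ x) := by
  have h1 := hx.apply_eq_smul
  rw [Matrix.toLin'_apply] at h1
  have h2 := congrArg (fun w => S.E u *ᵥ w) h1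
  simpa [Matrix.mulVec_mulVec, ← Matrix.mul_assoc, Matrix.mul_nonsing_inv _ (hS.isUnit_det_E hu),
    Matrix.mulVec_smul] using h2

/-- The kernel of `A(u)` is trivial unless `lam k u = 0`, and then it is spanned by `r u`. -/
theorem BoundaryCharacteristic.exists_of_mulVec_eq_zero
    {lam : Fin (h + m) → State h m → ℝ} {k : Fin (h + m)} {ustar : State h m}
    (hlam : S.BoundaryCharacteristic lam k ustar) {r : State h m → State h m}
    (hr : S.GenuinelyNonlinear (lam k) r) {u : State h m} (hu : u ∈ S.U)
    {x : Fin h ⊕ Fin m → ℝ} (hx : S.A u *ᵥ x = 0) (hx0 : x ≠ 0) :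
    lam k u = 0 ∧ ∃ c : ℝ, x = c • (r u).ofLp := by
  classical
  choose e he using fun i => (hlam.eigenvalue u hu i).exists_hasEigenvector
  -- With `r u` as the `k`-th vector of the eigenbasis, the expansion of `x` directly yields a
  -- multiple of `r u`; the gap excludes every other index for the eigenvalue `0`.
  set e' : Fin (h + m) → (Fin h ⊕ Fin m → ℝ) := Function.update e k (r u).ofLp
  have he' : ∀ i, Module.End.HasEigenvector (Matrix.toLin' ((S.E u)⁻¹ * S.A u)) (lam i u)
      (e' i) := by
    intro i
    by_cases hik : i = k
    · subst hik
      simpa [e'] using hr.eigenvector u hu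
    · simpa [e', hik] using he i
  obtain ⟨i, hi, c, hc⟩ := exists_eq_smul_of_distinct_eigenvalues (n := h + m) (by simp)
    (hlam.strictMono u hu).injective he' (x := x) (μ := 0)
    (by rw [Matrix.toLin'_apply, ← Matrix.mulVec_mulVec, hx]; simp) hx0
  obtain ⟨c₀, hc₀, hgap⟩ := hlam.gap
  have hik : i = k := by
    rcases lt_trichotomy i k with hlt | heq | hgt
    · have := (hgap u hu).1 i hlt
      linarith
    · exact heq
    · have := (hgap u hu).2 i hgt
      linarith
  subst hik
  exact ⟨hi.symm, c, by simpa [e'] using hc⟩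

theorem GenuinelyNonlinear.ne_zero {lamk : State h m → ℝ} {r : State h m → State h m}
    (hr : S.GenuinelyNonlinear lamk r) {u : State h m} (hu : u ∈ S.U) : (r u).ofLp ≠ 0 :=
  (hr.eigenvector u hu).2

theorem IsNormalForm.dotProduct_E_pos (hS : S.IsNormalForm) {u : State h m} (hu : u ∈ S.U)
    {x : Fin h ⊕ Fin m → ℝ} (hx : x ≠ 0) : 0 < x ⬝ᵥ (S.E u *ᵥ x) := by
  simpa using (hS.E_posDef u hu).dotProduct_mulVec_pos hx

theorem GenuinelyNonlinear.contDiffAt_r (hS : S.IsNormalForm) {lamk : State h m → ℝ}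
    {r : State h m → State h m} (hr : S.GenuinelyNonlinear lamk r) {u : State h m}
    (hu : u ∈ S.U) : ContDiffAt ℝ 2 r u :=
  hr.regular.contDiffAt (hS.isOpen_U.mem_nhds hu)

/-- Genuine nonlinearity asks only for differentiability of `lamk`. Continuity of its gradient comes
from the Rayleigh quotient `rᵗ A r / rᵗ E r`, whose denominator is positive. -/
theorem GenuinelyNonlinear.contDiffAt_lam (hS : S.IsNormalForm) {lamk : State h m → ℝ}
    {r : State h m → State h m} (hr : S.GenuinelyNonlinear lamk r) {u : State h m}
    (hu : u ∈ S.U) : ContDiffAt ℝ 1 lamk u := by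
  have hrd : ContDiffAt ℝ 1 r u := (hr.contDiffAt_r hS hu).of_le (by norm_num)
  have hnum : ContDiffAt ℝ 1 (fun w => (r w).ofLp ⬝ᵥ (S.A w *ᵥ (r w).ofLp)) u :=
    contDiffAt_dotProduct (contDiffAt_coord hrd) (contDiffAt_mulVec
      (fun i j => (hS.contDiffAt_entry hS.smooth_A hu i j).of_le (by simp)) (contDiffAt_coord hrd))
  have hden : ContDiffAt ℝ 1 (fun w => (r w).ofLp ⬝ᵥ (S.E w *ᵥ (r w).ofLp)) u :=
    contDiffAt_dotProduct (contDiffAt_coord hrd) (contDiffAt_mulVec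
      (fun i j => (hS.contDiffAt_entry hS.smooth_E hu i j).of_le (by simp)) (contDiffAt_coord hrd))
  refine (hnum.div hden (hS.dotProduct_E_pos hu (hr.ne_zero hu)).ne').congr_of_eventuallyEq ?_
  filter_upwards [hS.isOpen_U.mem_nhds hu] with w hw
  rw [Pi.div_apply, hS.mulVec_eq_of_hasEigenvector hw (hr.eigenvector w hw), dotProduct_smul, smul_eq_mul,
    mul_div_assoc, div_self (hS.dotProduct_E_pos hw (hr.ne_zero hw)).ne', mul_one]

/-! ### Regularity of the reduced vector field -/

variable {ustar : State h m} {W : Set (State h m × ℝ)} {p : State h m × ℝ → Par m}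

theorem contDiffAt_rc (hS : S.IsNormalForm) (hA : ∀ u ∈ S.U, (S.A11 u).det ≠ 0)
    (hp : S.IsCenterManifold ustar W p) {w : State h m × ℝ} (hw : w ∈ W) :
    ContDiffAt ℝ 3 (S.rc p) w := by
  have hu := hp.fst_mem w hw
  have hpd : ContDiffAt ℝ 3 p w := hp.regular.contDiffAt (hp.isOpen.mem_nhds hw)
  have hent : ∀ i j, ContDiffAt ℝ 3 (fun w : State h m × ℝ => S.A w.1 i j) w := fun i j =>
    ((hS.contDiffAt_entry hS.smooth_A hu i j).of_le
      (WithTop.coe_le_coe.2 le_top : ((3 : ℕ∞) : WithTop ℕ∞) ≤ ∞)).comp w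
      contDiffAt_fst
  refine contDiffAt_joinState (fun j => ?_) hpd
  refine ContDiffAt.neg (contDiffAt_mulVec (contDiffAt_matrix_inv (fun i j => hent _ _) (hA _ hu))
    (fun j => contDiffAt_mulVec (fun i j => hent _ _) (contDiffAt_coord hpd) j) j)

theorem contDiffAt_blMatrix (hS : S.IsNormalForm) (hA : ∀ u ∈ S.U, (S.A11 u).det ≠ 0)
    {E : Type*} [NormedAddCommGroup E] [NormedSpace ℝ E] {n : ℕ} {a q : E → State h m} {x₀ : E}
    (ha : ContDiffAt ℝ n a x₀) (hq : ContDiffAt ℝ n q x₀) (hu : a x₀ ∈ S.U) (i j) :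
    ContDiffAt ℝ n (fun x => S.blMatrix (a x) (q x) i j) x₀ := by
  have hent : ∀ i j, ContDiffAt ℝ n (fun x => S.A (a x) i j) x₀ := fun i j =>
    ((hS.contDiffAt_entry hS.smooth_A hu i j).of_le (by exact_mod_cast le_top)).comp x₀ ha
  have hpar : ContDiffAt ℝ n (fun x => parPart (q x)) x₀ :=
    contDiffAt_toLp fun j => contDiffAt_coord hq (Sum.inr j)
  have hG1 : ∀ i j, ContDiffAt ℝ n (fun x => S.G₁ (a x) (parPart (q x)) i j) x₀ := fun i j =>
    ContDiffAt.comp (g := fun w : State h m × Par m => S.G₁ w.1 w.2 i j) x₀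
      (((hS.smooth_G₁ i j).contDiffAt ((hS.isOpen_U.prod isOpen_univ).mem_nhds
        ⟨hu, mem_univ _⟩)).of_le (by exact_mod_cast le_top)) (ha.prodMk hpar)
  have hG2 : ∀ i j, ContDiffAt ℝ n (fun x => S.G₂ (a x) (q x) i j) x₀ := fun i j =>
    ContDiffAt.comp (g := fun w : State h m × State h m => S.G₂ w.1 w.2 i j) x₀
      (((hS.smooth_G₂ i j).contDiffAt ((hS.isOpen_U.prod isOpen_univ).mem_nhds
        ⟨hu, mem_univ _⟩)).of_le (by exact_mod_cast le_top)) (ha.prodMk hq)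
  refine ContDiffAt.sub (ContDiffAt.add (contDiffAt_matrix_mul (contDiffAt_matrix_mul
    (fun i j => (hG1 i j).sub (hent _ _)) (contDiffAt_matrix_inv (fun i j => hent _ _)
    (hA _ hu))) (fun i j => hent _ _) i j) (hent _ _)) (hG2 i j)

theorem contDiffAt_mulVec_B22 (hS : S.IsNormalForm) {E : Type*} [NormedAddCommGroup E]
    [NormedSpace ℝ E] {n : ℕ} {a : E → State h m} {q : E → Par m} {x₀ : E}
    (ha : ContDiffAt ℝ n a x₀) (hq : ContDiffAt ℝ n q x₀) (hu : a x₀ ∈ S.U) (j) :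
    ContDiffAt ℝ n (fun x => (S.B22 (a x) *ᵥ q x) j) x₀ :=
  contDiffAt_mulVec (fun i j => ((hS.contDiffAt_entry hS.smooth_B hu _ _).of_le
    (by exact_mod_cast le_top)).comp x₀ ha) (contDiffAt_coord hq) j

theorem contDiffAt_fderiv_p (hp : S.IsCenterManifold ustar W p) {w : State h m × ℝ} (hw : w ∈ W) :
    ContDiffAt ℝ 2 (fderiv ℝ p) w :=
  (hp.regular.contDiffAt (hp.isOpen.mem_nhds hw)).fderiv_right (by norm_num)

theorem contDiffAt_thetac (hS : S.IsNormalForm) (hA : ∀ u ∈ S.U, (S.A11 u).det ≠ 0)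
    (hp : S.IsCenterManifold ustar W p) {w : State h m × ℝ} (hw : w ∈ W)
    (hden : 1 + w.2 * ((p w).ofLp ⬝ᵥ (S.B22 w.1 *ᵥ (fderiv ℝ p w (0, 1)))) ≠ 0) :
    ContDiffAt ℝ 1 (S.thetac p) w := by
  have hu := hp.fst_mem w hw
  have hpd : ContDiffAt ℝ 1 p w :=
    (hp.regular.contDiffAt (hp.isOpen.mem_nhds hw)).of_le (by norm_num)
  have hdp : ContDiffAt ℝ 1 (fderiv ℝ p) w := (contDiffAt_fderiv_p hp hw).of_le (by norm_num)
  have hrc : ContDiffAt ℝ 1 (S.rc p) w := (contDiffAt_rc hS hA hp hw).of_le (by norm_num)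
  have hB := fun (q : State h m × ℝ → Par m) (hq : ContDiffAt ℝ 1 q w) (j : Fin m) =>
    contDiffAt_mulVec_B22 hS (n := 1) (a := Prod.fst) contDiffAt_fst hq hu j
  refine ContDiffAt.div (ContDiffAt.sub ?_ ?_) ?_ hden
  · exact contDiffAt_dotProduct (contDiffAt_coord hpd) (contDiffAt_mulVec
      (contDiffAt_blMatrix hS hA (n := 1) contDiffAt_fst (contDiffAt_snd.smul hrc) hu)
      (contDiffAt_coord hpd))
  · exact contDiffAt_snd.mul (contDiffAt_dotProduct (contDiffAt_coord hpd)
      (hB _ (hdp.clm_apply (hrc.prodMk contDiffAt_const))))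
  · exact contDiffAt_const.add (contDiffAt_snd.mul (contDiffAt_dotProduct (contDiffAt_coord hpd)
      (hB _ (hdp.clm_apply contDiffAt_const))))

/-! ### The reduced vector field where the eigenvalue vanishes -/

theorem blMatrix_zero (hS : S.IsNormalForm) {u : State h m} (hu : u ∈ S.U) :
    S.blMatrix u 0 = S.A22 u - S.A21 u * (S.A11 u)⁻¹ * (S.A21 u)ᵀ := by
  have h0 : parPart (0 : State h m) = 0 := by ext; simp [parPart]
  rw [blMatrix, h0, hS.G₁_zero u hu, hS.G₂_zero u hu]
  simp only [zero_sub, Matrix.neg_mul, sub_zero]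
  abel

theorem toBlocks₁₂_A (hS : S.IsNormalForm) {u : State h m} (hu : u ∈ S.U) :
    (S.A u).toBlocks₁₂ = (S.A21 u)ᵀ := by
  ext i j
  exact (hS.A_symm u hu).apply _ _

theorem A_eq_fromBlocks (hS : S.IsNormalForm) {u : State h m} (hu : u ∈ S.U) :
    S.A u = Matrix.fromBlocks (S.A11 u) (S.A21 u)ᵀ (S.A21 u) (S.A22 u) := by
  rw [← toBlocks₁₂_A hS hu]
  exact (Matrix.fromBlocks_toBlocks _).symm

theorem A_mulVec_lift (hS : S.IsNormalForm) (hA : ∀ u ∈ S.U, (S.A11 u).det ≠ 0) {u : State h m}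
    (hu : u ∈ S.U) (z : Par m) : S.A u *ᵥ (S.lift u z).ofLp =
      (joinState 0 (WithLp.toLp 2
        ((S.A22 u - S.A21 u * (S.A11 u)⁻¹ * (S.A21 u)ᵀ) *ᵥ z)) : State h m).ofLp := by
  have h1 : (S.lift u z).ofLp = Sum.elim (-((S.A11 u)⁻¹ *ᵥ ((S.A21 u)ᵀ *ᵥ z))) z.ofLp := rfl
  rw [A_eq_fromBlocks hS hu, h1, Matrix.fromBlocks_mulVec]
  have h2 : S.A11 u *ᵥ ((S.A11 u)⁻¹ *ᵥ ((S.A21 u)ᵀ *ᵥ z.ofLp)) = (S.A21 u)ᵀ *ᵥ z.ofLp := by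
    rw [Matrix.mulVec_mulVec, Matrix.mul_nonsing_inv _ (isUnit_iff_ne_zero.2 (hA u hu)),
      Matrix.one_mulVec]
  simp only [joinState, Sum.elim_comp_inl, Sum.elim_comp_inr, Matrix.mulVec_neg, h2]
  congr 1
  · simp
  · rw [Matrix.sub_mulVec, Matrix.mulVec_mulVec, Matrix.mulVec_mulVec, Matrix.mul_assoc]
    exact neg_add_eq_sub _ _

/-- Here `r_c(u, 0)` lies in the kernel of `A`. By the choice of its first block, the remaining
equation says that the Schur complement of `A₁₁`, which is `blMatrix u 0`, annihilates `p`. -/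
theorem thetac_eq_zero (hS : S.IsNormalForm) (hA : ∀ u ∈ S.U, (S.A11 u).det ≠ 0)
    {lamk : State h m → ℝ} {r : State h m → State h m} (hr : S.GenuinelyNonlinear lamk r)
    {u : State h m} (hu : u ∈ S.U) (hlam : lamk u = 0) (hrp : S.rc p (u, 0) = r u) :
    S.thetac p (u, 0) = 0 := by
  have h1 := hS.mulVec_eq_of_hasEigenvector hu (hr.eigenvector u hu)
  rw [hlam, zero_smul, ← hrp, rc, A_mulVec_lift hS hA hu] at h1
  have h2 : (S.A22 u - S.A21 u * (S.A11 u)⁻¹ * (S.A21 u)ᵀ) *ᵥ (p (u, 0)).ofLp = 0 := by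
    ext j
    exact congrFun h1 (Sum.inr j)
  simp only [thetac, zero_smul, zero_mul, sub_zero, blMatrix_zero hS hu, h2, dotProduct_zero,
    zero_div]

end ViscousSystem

/-! ### Zero-speed shocks -/

/-- Rolle's theorem on each of the two intervals produces two distinct critical points of `k`, hence
two zeros of the strictly increasing `q`. -/
theorem false_of_three_equal_values {k k' q : ℝ → ℝ} {J : Set ℝ} (hJ : Convex ℝ J)
    (hk : ∀ t ∈ J, HasDerivAt k (k' t) t) (hq : StrictMonoOn q J)
    (hkq : ∀ t ∈ J, k' t = 0 → q t = 0) {x y z : ℝ} (hx : x ∈ J) (hy : y ∈ J) (hz : z ∈ J)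
    (hxy : x < y) (hyz : y < z) (h1 : k x = k y) (h2 : k y = k z) : False := by
  have aux : ∀ {a b : ℝ}, a ∈ J → b ∈ J → a < b → k a = k b →
      ∃ t ∈ Ioo a b, t ∈ J ∧ q t = 0 := by
    intro a b ha hb hab hkab
    have hsub : Icc a b ⊆ J := hJ.ordConnected.out ha hb
    obtain ⟨t, ht, ht0⟩ := exists_hasDerivAt_eq_zero hab
      (fun t ht => (hk t (hsub ht)).continuousAt.continuousWithinAt) hkab
      (fun t ht => hk t (hsub (Ioo_subset_Icc_self ht)))
    exact ⟨t, ht, hsub (Ioo_subset_Icc_self ht), hkq t (hsub (Ioo_subset_Icc_self ht)) ht0⟩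
  obtain ⟨t, ht, htJ, ht0⟩ := aux hx hy hxy h1
  obtain ⟨t', ht', htJ', ht0'⟩ := aux hy hz hyz h2
  have := hq htJ htJ' (ht.2.trans ht'.1)
  linarith

namespace ViscousSystem

variable {h m : ℕ} {S : ViscousSystem h m}

theorem contDiffAt_comp_v (hS : S.IsNormalForm) {Y : Type*} [NormedAddCommGroup Y]
    [NormedSpace ℝ Y] {φ : State h m → Y} (hφ : ContDiffOn ℝ ∞ φ S.V) {u : State h m}
    (hu : u ∈ S.U) : ContDiffAt ℝ ∞ (φ ∘ S.v) u :=
  (hφ.contDiffAt (hS.isOpen_V.mem_nhds (hS.bijOn_v.mapsTo hu))).comp u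
    (hS.smooth_v.contDiffAt (hS.isOpen_U.mem_nhds hu))

theorem A_mulVec_eq_zero_of_fderiv (hS : S.IsNormalForm) {u x : State h m} (hu : u ∈ S.U)
    (hx : fderiv ℝ (S.f ∘ S.v) u x = 0) : S.A u *ᵥ x = 0 := by
  obtain ⟨M, -, h2, -⟩ := hS.rewriting u hu
  have := h2 x
  rw [hx, map_zero] at this
  exact (congrArg WithLp.ofLp this).symm

theorem inner_toLp_mulVec_comm {ι : Type*} [Fintype ι] {P : Matrix ι ι ℝ} (hP : P.IsSymm)
    (x y : EuclideanSpace ℝ ι) :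
    inner ℝ x (WithLp.toLp 2 (P *ᵥ y.ofLp)) = inner ℝ (WithLp.toLp 2 (P *ᵥ x.ofLp)) y := by
  simp only [EuclideanSpace.inner_eq_star_dotProduct, star_trivial]
  rw [dotProduct_comm, Matrix.dotProduct_mulVec, ← Matrix.mulVec_transpose, hP.eq, dotProduct_comm]

/-- Three states with the same flux that are close to a state where the eigenvalue vanishes cannot
be pairwise distinct. -/
theorem exists_ball_flux_fold (hS : S.IsNormalForm) {lam : Fin (h + m) → State h m → ℝ}
    {k : Fin (h + m)} {ustar : State h m} (hlam : S.BoundaryCharacteristic lam k ustar)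
    {r : State h m → State h m} (hr : S.GenuinelyNonlinear (lam k) r) :
    ∃ δ > 0, ∀ a ∈ Metric.ball ustar δ, ∀ b ∈ Metric.ball ustar δ, ∀ c ∈ Metric.ball ustar δ,
      S.f (S.v a) = S.f (S.v b) → S.f (S.v a) = S.f (S.v c) → a ≠ b → a ≠ c → b = c := by
  have hU := hlam.mem_U
  obtain ⟨M, -, hMA, -⟩ := hS.rewriting ustar hU
  set F : State h m → State h m := S.f ∘ S.v with hF
  set e : State h m := r ustar with he
  have he0 : e ≠ 0 := fun h0 => hr.ne_zero hU (by rw [← he, h0]; rfl)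
  have hee : 0 < inner ℝ e e := real_inner_self_pos.2 he0
  have hAe : S.A ustar *ᵥ e.ofLp = 0 := by
    rw [hS.mulVec_eq_of_hasEigenvector hU (hr.eigenvector ustar hU), hlam.vanish, zero_smul]
  -- Lyapunov–Schmidt reduction: the derivative of `M ∘ F` at `ustar` is `A`, with kernel spanned by
  -- `e`. The rank-one term `⟨e, x⟩ e` makes the derivative invertible, and `Θ` below is the local
  -- inverse of `Ψ`.
  set Ψ : State h m → State h m := fun x => M (F x) + inner ℝ e x • e with hΨ
  have hFd : ∀ x ∈ S.U, ContDiffAt ℝ ∞ F x := fun x hx => contDiffAt_comp_v hS hS.smooth_f hx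
  have hΨd : ∀ x ∈ S.U, HasFDerivAt Ψ ((M : State h m →L[ℝ] State h m).comp (fderiv ℝ F x) +
      (innerSL ℝ e).smulRight e) x := fun x hx =>
    ((M : State h m →L[ℝ] State h m).hasFDerivAt.comp x
      ((hFd x hx).differentiableAt (by simp)).hasFDerivAt).add
      (((innerSL ℝ e).hasFDerivAt).smul_const e)
  set L := (M : State h m →L[ℝ] State h m).comp (fderiv ℝ F ustar) + (innerSL ℝ e).smulRight e
    with hL
  have hLx : ∀ x, L x = WithLp.toLp 2 (S.A ustar *ᵥ x.ofLp) + inner ℝ e x • e := fun x => by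
    simp only [hL, add_apply, ContinuousLinearMap.comp_apply,
      ContinuousLinearEquiv.coe_coe, hMA, ContinuousLinearMap.smulRight_apply, innerSL_apply_apply]
  -- Pairing with `e` removes the `A` part, since `A` is symmetric and `A e = 0`. Hence `x` is
  -- orthogonal to `e` and in the kernel of `A`, which forces `x = 0`.
  have hLinj : Function.Injective L := by
    rw [injective_iff_map_eq_zero]
    intro x hx
    rw [hLx] at hx
    have h1 := congrArg (fun y => inner ℝ e y) hx
    simp only [inner_add_right, inner_smul_right, inner_zero_right] at h1
    rw [inner_toLp_mulVec_comm (hS.A_symm ustar hU), hAe] at h1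
    have h2 : inner ℝ e x = 0 := by
      simpa [he0] using h1
    rw [h2, zero_smul, add_zero] at hx
    by_contra hx0
    obtain ⟨-, c, hc⟩ := hlam.exists_of_mulVec_eq_zero hr hU (x := x.ofLp)
      (congrArg WithLp.ofLp hx) (fun h0 => hx0 (by ext j; exact congrFun h0 j))
    have hc' : x = c • e := by ext j; exact congrFun hc j
    rw [hc', inner_smul_right, mul_eq_zero] at h2
    rcases h2 with h2 | h2
    · exact hx0 (by rw [hc', h2, zero_smul])
    · exact hee.ne' h2
  set L' : State h m ≃L[ℝ] State h m :=
    (LinearEquiv.ofInjectiveEndo (L : State h m →ₗ[ℝ] State h m) hLinj).toContinuousLinearEquiv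
  have hL' : (L' : State h m →L[ℝ] State h m) = L := by ext x; rfl
  have hΨ1 : ContDiffAt ℝ 1 Ψ ustar :=
    (((M : State h m →L[ℝ] State h m).contDiff.contDiffAt.comp ustar
      ((hFd ustar hU).of_le (by simp)))).add
      ((innerSL ℝ e).contDiff.contDiffAt.smul contDiffAt_const)
  have hΨL : HasFDerivAt Ψ (L' : State h m →L[ℝ] State h m) ustar := by
    rw [hL']; exact hΨd ustar hU
  have hstrict : HasStrictFDerivAt Ψ (L' : State h m →L[ℝ] State h m) ustar :=
    hΨ1.hasStrictFDerivAt' hΨL (by norm_num)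
  set Θ := hstrict.localInverse Ψ L' ustar
  have e1 : ∀ᶠ x in 𝓝 ustar, Θ (Ψ x) = x := hstrict.eventually_left_inverse
  have e2 : ∀ᶠ w in 𝓝 (Ψ ustar), Ψ (Θ w) = w := hstrict.eventually_right_inverse
  have hΘ0 : Θ (Ψ ustar) = ustar := hstrict.localInverse_apply_image
  have hΘ1 : ContDiffAt ℝ 1 Θ (Ψ ustar) := hΨ1.to_localInverse hΨL (by norm_num)
  have hΘe : fderiv ℝ Θ (Ψ ustar) e = (inner ℝ e e)⁻¹ • e := by
    have h1 : fderiv ℝ Θ (Ψ ustar) = (L'.symm : State h m →L[ℝ] State h m) :=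
      hstrict.to_localInverse.hasFDerivAt.fderiv
    rw [h1, ContinuousLinearEquiv.coe_coe, ContinuousLinearEquiv.symm_apply_eq]
    change e = L _
    rw [map_smul, hLx, hAe]
    simp only [WithLp.toLp_zero, zero_add, smul_smul, inv_mul_cancel₀ hee.ne', one_smul]
  have hlam1 : ContDiffAt ℝ 1 (lam k) ustar := hr.contDiffAt_lam hS hU
  obtain ⟨d, hd, hgnl⟩ := hr.gnl
  have hΘc : ContinuousAt Θ (Ψ ustar) := hΘ1.continuousAt
  -- Genuine nonlinearity in the coordinates `Ψ`: since `DΘ e = e / |e|²` at the base point, `lam k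
  -- ∘ Θ` increases in the direction `e`.
  have hpos : ∀ᶠ w in 𝓝 (Ψ ustar), 0 < fderiv ℝ (lam k) (Θ w) (fderiv ℝ Θ w e) := by
    have hc1 : ContinuousAt (fun w => fderiv ℝ (lam k) (Θ w)) (Ψ ustar) :=
      ContinuousAt.comp (g := fderiv ℝ (lam k)) (by
        rw [hΘ0]; exact (hlam1.fderiv_right (m := 0) (by norm_num)).continuousAt) hΘc
    have hc2 : ContinuousAt (fun w => fderiv ℝ Θ w e) (Ψ ustar) :=
      (hΘ1.fderiv_right (m := 0) (by norm_num)).continuousAt.clm_apply continuousAt_const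
    refine (hc1.clm_apply hc2).eventually (lt_mem_nhds ?_)
    change 0 < fderiv ℝ (lam k) (Θ (Ψ ustar)) (fderiv ℝ Θ (Ψ ustar) e)
    rw [hΘ0, hΘe, map_smul, smul_eq_mul]
    exact mul_pos (inv_pos.2 hee) (hd.trans_le (hgnl ustar hU).2)
  have hUev : ∀ᶠ w in 𝓝 (Ψ ustar), Θ w ∈ S.U := by
    refine hΘc.eventually ?_
    rw [hΘ0]
    exact hS.isOpen_U.mem_nhds hU
  have hdiff : ∀ᶠ w in 𝓝 (Ψ ustar), DifferentiableAt ℝ Θ w :=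
    (hΘ1.eventually (by simp)).mono fun w hw => hw.differentiableAt (by norm_num)
  obtain ⟨ε, hε, hball⟩ := Metric.eventually_nhds_iff_ball.1
    (e2.eventually_nhds.and (hpos.and (hUev.and hdiff)))
  obtain ⟨δ, hδ, hballδ⟩ := Metric.eventually_nhds_iff_ball.1
    (e1.and (hΨ1.continuousAt.eventually (Metric.ball_mem_nhds _ hε)))
  refine ⟨δ, hδ, fun a ha b hb c hc hab hac hne hne' => ?_⟩
  -- A state `b` with the flux of `a` has its image `Ψ b` on this line, at the parameter `t = ⟨e, b
  -- - a⟩`. At each such parameter `t - ⟨e, Θ (w t)⟩` takes the same value `-⟨e, a⟩`, so three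
  -- states would give three equal values of one scalar function.
  set w : ℝ → State h m := fun t => Ψ a + t • e with hw
  set J : Set ℝ := w ⁻¹' Metric.ball (Ψ ustar) ε with hJdef
  have hwd : ∀ t, HasDerivAt w e t := fun t => by
    have := ((hasDerivAt_id t).smul_const e).const_add (Ψ a)
    rw [one_smul] at this
    exact this
  have hJ : Convex ℝ J := by
    intro x hx y hy s t hs ht hst
    have h1 := convex_ball (Ψ ustar) ε hx hy hs ht hst
    rw [hJdef, mem_preimage]
    convert h1 using 1
    obtain rfl : t = 1 - s := by linarith
    simp only [hw, smul_eq_mul]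
    module
  have hx : ∀ t ∈ J, HasDerivAt (fun t => Θ (w t)) (fderiv ℝ Θ (w t) e) t := fun t ht =>
    (hball _ ht).2.2.2.hasFDerivAt.comp_hasDerivAt t (hwd t)
  have hk : ∀ t ∈ J, HasDerivAt (fun t => t - inner ℝ e (Θ (w t)))
      (1 - inner ℝ e (fderiv ℝ Θ (w t) e)) t := fun t ht =>
    (hasDerivAt_id t).sub ((innerSL ℝ e).hasFDerivAt.comp_hasDerivAt t (hx t ht))
  have hq : StrictMonoOn (fun t => lam k (Θ (w t))) J := by
    have hqd : ∀ t ∈ J, HasDerivAt (fun t => lam k (Θ (w t)))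
        (fderiv ℝ (lam k) (Θ (w t)) (fderiv ℝ Θ (w t) e)) t := fun t ht =>
      (hgnl _ (hball _ ht).2.2.1).1.hasFDerivAt.comp_hasDerivAt t (hx t ht)
    refine strictMonoOn_of_deriv_pos hJ
      (fun t ht => (hqd t ht).continuousAt.continuousWithinAt) fun t ht => ?_
    have htJ : t ∈ J := interior_subset ht
    rw [(hqd t htJ).deriv]
    exact (hball _ htJ).2.1
  -- Differentiating `Ψ ∘ Θ = id` in the direction `e` gives `M DF(DΘ e) + ⟨e, DΘ e⟩ e = e`. At a
  -- critical point `⟨e, DΘ e⟩ = 1`, so `DΘ e` is a nonzero kernel vector of `DF`, hence of `A`, and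
  -- the eigenvalue vanishes.
  have hkq : ∀ t ∈ J, 1 - inner ℝ e (fderiv ℝ Θ (w t) e) = 0 → lam k (Θ (w t)) = 0 := by
    intro t ht h0
    obtain ⟨hinv, -, htU, htd⟩ := hball _ ht
    have h1 : HasFDerivAt (fun w => Ψ (Θ w)) (ContinuousLinearMap.id ℝ (State h m)) (w t) :=
      (hasFDerivAt_id (w t)).congr_of_eventuallyEq hinv
    have h2 := h1.unique ((hΨd _ htU).comp (w t) htd.hasFDerivAt)
    have h3 := congrArg (fun T : State h m →L[ℝ] State h m => T e) h2
    simp only [ContinuousLinearMap.id_apply, ContinuousLinearMap.comp_apply,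
      add_apply, ContinuousLinearEquiv.coe_coe,
      ContinuousLinearMap.smulRight_apply, innerSL_apply_apply, ← sub_eq_zero.1 h0, one_smul] at h3
    rw [right_eq_add, EmbeddingLike.map_eq_zero_iff] at h3
    refine (hlam.exists_of_mulVec_eq_zero hr htU (A_mulVec_eq_zero_of_fderiv hS htU h3) ?_).1
    intro h4
    have h5 : fderiv ℝ Θ (w t) e = 0 := by ext j; exact congrFun h4 j
    rw [h5, inner_zero_right, sub_zero] at h0
    exact one_ne_zero h0
  have hline : ∀ b ∈ Metric.ball ustar δ, S.f (S.v a) = S.f (S.v b) →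
      w (inner ℝ e (b - a)) = Ψ b := by
    intro b hb hfb
    have : F b = F a := hfb.symm
    simp only [hw, hΨ, this, inner_sub_right, sub_smul]
    abel
  have hmem : ∀ b ∈ Metric.ball ustar δ, S.f (S.v a) = S.f (S.v b) →
      inner ℝ e (b - a) ∈ J := fun b hb hfb => by
    rw [hJdef, mem_preimage, hline b hb hfb]
    exact (hballδ b hb).2
  have hval : ∀ b ∈ Metric.ball ustar δ, S.f (S.v a) = S.f (S.v b) →
      inner ℝ e (b - a) - inner ℝ e (Θ (w (inner ℝ e (b - a)))) = - inner ℝ e a :=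
    fun b hb hfb => by
    rw [hline b hb hfb, (hballδ b hb).1, inner_sub_right]
    ring
  have hinj : ∀ b ∈ Metric.ball ustar δ, ∀ c ∈ Metric.ball ustar δ,
      S.f (S.v a) = S.f (S.v b) → S.f (S.v a) = S.f (S.v c) →
      inner ℝ e (b - a) = inner ℝ e (c - a) → b = c := by
    intro b hb c hc hfb hfc hbc
    rw [← (hballδ b hb).1, ← hline b hb hfb, hbc, hline c hc hfc, (hballδ c hc).1]
  have key : ∀ x ∈ Metric.ball ustar δ, ∀ y ∈ Metric.ball ustar δ, ∀ z ∈ Metric.ball ustar δ,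
      S.f (S.v a) = S.f (S.v x) → S.f (S.v a) = S.f (S.v y) → S.f (S.v a) = S.f (S.v z) →
      inner ℝ e (x - a) < inner ℝ e (y - a) → inner ℝ e (y - a) < inner ℝ e (z - a) → False :=
    fun x hx y hy z hz hfx hfy hfz hxy hyz =>
      false_of_three_equal_values hJ hk hq hkq (hmem x hx hfx) (hmem y hy hfy) (hmem z hz hfz)
        hxy hyz ((hval x hx hfx).trans (hval y hy hfy).symm)
        ((hval y hy hfy).trans (hval z hz hfz).symm)
  by_contra hbc
  have n1 := mt (hinj a ha b hb rfl hab) hne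
  have n2 := mt (hinj a ha c hc rfl hac) hne'
  have n3 := mt (hinj b hb c hc hab hac) hbc
  rcases lt_or_gt_of_ne n1 with h1 | h1 <;> rcases lt_or_gt_of_ne n2 with h2 | h2 <;>
    rcases lt_or_gt_of_ne n3 with h3 | h3
  · exact key a ha b hb c hc rfl hab hac h1 h3
  · exact key a ha c hc b hb rfl hac hab h2 h3
  · exact absurd (h1.trans h3) h2.not_gt
  · exact key c hc a ha b hb hac rfl hab h2 h1
  · exact key b hb a ha c hc hab rfl hac h1 h2
  · exact absurd (h2.trans h3) h1.not_gt
  · exact key b hb c hc a ha hab hac rfl h3 h2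
  · exact key c hc b hb a ha hac hab rfl h3 h1

end ViscousSystem

/-! ### The derivative of the shock speed -/

theorem hasDerivAt_snd_of_differentiableAt {X Y : Type*} [NormedAddCommGroup X] [NormedSpace ℝ X]
    [NormedAddCommGroup Y] [NormedSpace ℝ Y] {f : X × ℝ → Y} {x : X} {s : ℝ}
    (hf : DifferentiableAt ℝ f (x, s)) :
    HasDerivAt (fun t => f (x, t)) (fderiv ℝ f (x, s) (0, 1)) s :=
  hf.hasFDerivAt.comp_hasDerivAt s ((hasDerivAt_const s x).prodMk (hasDerivAt_id s))

namespace ViscousSystem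

variable {h m : ℕ} {S : ViscousSystem h m}

theorem IsHugoniotCurve.contDiffAt {ustar : State h m} {lamk : State h m → ℝ}
    {r : State h m → State h m} {H : State h m → ℝ → State h m} {σ : State h m → ℝ → ℝ}
    (hH : S.IsHugoniotCurve ustar lamk r H σ) :
    ContDiffAt ℝ 2 (fun q : State h m × ℝ => H q.1 q.2) (ustar, 0) ∧
      ContDiffAt ℝ 2 (fun q : State h m × ℝ => σ q.1 q.2) (ustar, 0) := by
  obtain ⟨ρ, hρ, h1, h2, -⟩ := hH
  have hmem : Metric.ball ustar ρ ×ˢ Ioo (-ρ) ρ ∈ 𝓝 (ustar, (0 : ℝ)) :=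
    prod_mem_nhds (Metric.ball_mem_nhds _ hρ) (Ioo_mem_nhds (by linarith) hρ)
  exact ⟨h1.contDiffAt hmem, h2.contDiffAt hmem⟩

theorem fderiv_flux_apply_r (hS : S.IsNormalForm) {lamk : State h m → ℝ}
    {r : State h m → State h m} (hr : S.GenuinelyNonlinear lamk r) {u : State h m}
    (hu : u ∈ S.U) :
    fderiv ℝ (S.f ∘ S.v) u (r u) = lamk u • fderiv ℝ (S.g ∘ S.v) u (r u) := by
  obtain ⟨M, h1, h2, -⟩ := hS.rewriting u hu
  apply M.injective
  rw [map_smul, h1, h2, hS.mulVec_eq_of_hasEigenvector hu (hr.eigenvector u hu),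
    WithLp.toLp_smul]

/-- The functional `N = ⟨e, M ·⟩` annihilates the range of `DF(u*)` because `A` is symmetric with `A
e = 0`. Differentiating `DF r = λ DG r` along `r` gives `N D²F(e, e) = (∇λ · e) N DG e`;
differentiating Rankine–Hugoniot twice gives `N D²F(e, e) = 2 σ' N DG e`, where `N` removes the
second derivative of `H`. Finally `N DG e = eᵗ E e > 0`. -/
theorem two_mul_deriv_shockSpeed (hS : S.IsNormalForm) {lam : Fin (h + m) → State h m → ℝ}
    {k : Fin (h + m)} {ustar : State h m} (hlam : S.BoundaryCharacteristic lam k ustar)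
    {r : State h m → State h m} (hr : S.GenuinelyNonlinear (lam k) r)
    {H : State h m → ℝ → State h m} {σ : State h m → ℝ → ℝ}
    (hH : S.IsHugoniotCurve ustar (lam k) r H σ) :
    2 * fderiv ℝ (fun q : State h m × ℝ => σ q.1 q.2) (ustar, 0) (0, 1) =
      fderiv ℝ (lam k) ustar (r ustar) := by
  have hU := hlam.mem_U
  obtain ⟨hH2, hσ2⟩ := hH.contDiffAt
  obtain ⟨ρ, hρ, -, -, hRH⟩ := hH
  obtain ⟨hH0, hH1, hσ0, hRH⟩ := hRH ustar (Metric.mem_ball_self hρ)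
  rw [hlam.vanish] at hσ0
  obtain ⟨M, hME, hMA, -⟩ := hS.rewriting ustar hU
  set F : State h m → State h m := S.f ∘ S.v
  set G : State h m → State h m := S.g ∘ S.v
  set e : State h m := r ustar with he
  set N : State h m →L[ℝ] ℝ := (innerSL ℝ e).comp (M : State h m →L[ℝ] State h m)
  have hAe : S.A ustar *ᵥ e.ofLp = 0 := by
    rw [hS.mulVec_eq_of_hasEigenvector hU (hr.eigenvector ustar hU), hlam.vanish, zero_smul]
  have hF : ∀ x ∈ S.U, ContDiffAt ℝ ∞ F x := fun x hx => contDiffAt_comp_v hS hS.smooth_f hx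
  have hG : ∀ x ∈ S.U, ContDiffAt ℝ ∞ G x := fun x hx => contDiffAt_comp_v hS hS.smooth_g hx
  have hdF : DifferentiableAt ℝ (fderiv ℝ F) ustar :=
    ((hF ustar hU).fderiv_right (m := 1) (by norm_cast)).differentiableAt (by norm_num)
  have hdG : DifferentiableAt ℝ (fderiv ℝ G) ustar :=
    ((hG ustar hU).fderiv_right (m := 1) (by norm_cast)).differentiableAt (by norm_num)
  have hNF : ∀ x, N (fderiv ℝ F ustar x) = 0 := fun x => by
    change inner ℝ e (M (fderiv ℝ F ustar x)) = 0
    rw [hMA, inner_toLp_mulVec_comm (hS.A_symm ustar hU), hAe, WithLp.toLp_zero, inner_zero_left]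
  have hNG : 0 < N (fderiv ℝ G ustar e) := by
    change 0 < inner ℝ e (M (fderiv ℝ G ustar e))
    rw [hME]
    have := hS.dotProduct_E_pos hU (hr.ne_zero hU)
    rwa [EuclideanSpace.inner_eq_star_dotProduct, star_trivial, dotProduct_comm]
  -- differentiate the eigenvalue relation along the eigenvector field
  have hrd : HasFDerivAt r (fderiv ℝ r ustar) ustar :=
    ((hr.contDiffAt_r hS hU).differentiableAt (by norm_num)).hasFDerivAt
  obtain ⟨d, -, hgnl⟩ := hr.gnl
  have hI : N (fderiv ℝ (fderiv ℝ F) ustar e e) =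
      fderiv ℝ (lam k) ustar e * N (fderiv ℝ G ustar e) := by
    have h1 := N.hasFDerivAt.comp ustar (hdF.hasFDerivAt.clm_apply hrd)
    have h2 := (hgnl ustar hU).1.hasFDerivAt.mul
      (N.hasFDerivAt.comp ustar (hdG.hasFDerivAt.clm_apply hrd))
    have h3 : (fun x => N (fderiv ℝ F x (r x))) =ᶠ[𝓝 ustar]
        fun x => lam k x * N (fderiv ℝ G x (r x)) := by
      filter_upwards [hS.isOpen_U.mem_nhds hU] with x hx
      rw [fderiv_flux_apply_r hS hr hx, map_smul, smul_eq_mul]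
    have h4 := congrArg (fun T : State h m →L[ℝ] ℝ => T e)
      ((h1.congr_of_eventuallyEq h3.symm).unique h2)
    simp [hNF, hlam.vanish, ← he] at h4
    linarith
  -- differentiate the Rankine-Hugoniot relation twice
  set H' : State h m × ℝ → State h m :=
    fun q => fderiv ℝ (fun q : State h m × ℝ => H q.1 q.2) q (0, 1)
  set σ' : State h m × ℝ → ℝ :=
    fun q => fderiv ℝ (fun q : State h m × ℝ => σ q.1 q.2) q (0, 1)
  have hcurve : ContinuousAt (fun s : ℝ => (ustar, s)) 0 := by fun_prop
  have hHev : ∀ᶠ s in 𝓝 (0 : ℝ), HasDerivAt (H ustar) (H' (ustar, s)) s :=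
    (hcurve.eventually (hH2.eventually (by simp))).mono fun s hs =>
      hasDerivAt_snd_of_differentiableAt (hs.differentiableAt (by norm_num))
  have hσev : ∀ᶠ s in 𝓝 (0 : ℝ), HasDerivAt (σ ustar) (σ' (ustar, s)) s :=
    (hcurve.eventually (hσ2.eventually (by simp))).mono fun s hs =>
      hasDerivAt_snd_of_differentiableAt (hs.differentiableAt (by norm_num))
  have hH'0 : H' (ustar, 0) = e := hHev.self_of_nhds.unique hH1
  have hH'd : ∃ a, HasDerivAt (fun s => H' (ustar, s)) a 0 :=
    ⟨_, hasDerivAt_snd_of_differentiableAt (((hH2.fderiv_right (m := 1) (by norm_num)).clm_apply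
      contDiffAt_const).differentiableAt (by norm_num))⟩
  have hσ'd : ∃ a, HasDerivAt (fun s => σ' (ustar, s)) a 0 :=
    ⟨_, hasDerivAt_snd_of_differentiableAt (((hσ2.fderiv_right (m := 1) (by norm_num)).clm_apply
      contDiffAt_const).differentiableAt (by norm_num))⟩
  obtain ⟨a, ha⟩ := hH'd
  obtain ⟨b, hb⟩ := hσ'd
  have hIoo : ∀ᶠ s in 𝓝 (0 : ℝ), s ∈ Ioo (-ρ) ρ := Ioo_mem_nhds (by linarith) hρ
  have hcomp : ∀ {Y : State h m → State h m}, (∀ x ∈ S.U, ContDiffAt ℝ ∞ Y x) →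
      ∀ᶠ s in 𝓝 (0 : ℝ), HasDerivAt (fun s => N (Y (H ustar s) - Y ustar))
        (N (fderiv ℝ Y (H ustar s) (H' (ustar, s)))) s := by
    intro Y hY
    filter_upwards [hHev, hIoo] with s hs hsρ
    have h1 := ((hY _ (hRH s hsρ).1).differentiableAt (by simp)).hasFDerivAt.comp_hasDerivAt s hs
    exact N.hasFDerivAt.comp_hasDerivAt s (h1.sub_const (Y ustar))
  have hRH' : ∀ᶠ s in 𝓝 (0 : ℝ), N (fderiv ℝ F (H ustar s) (H' (ustar, s))) =
      σ' (ustar, s) * N (G (H ustar s) - G ustar) +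
        σ ustar s * N (fderiv ℝ G (H ustar s) (H' (ustar, s))) := by
    filter_upwards [hcomp hF, hcomp hG, hσev, hIoo.eventually_nhds] with s h1 h2 h3 h4
    refine h1.unique ((h3.mul h2).congr_of_eventuallyEq ?_)
    filter_upwards [h4] with t ht
    have := (hRH t ht).2
    change F (H ustar t) - F ustar = _ • (G (H ustar t) - G ustar) at this
    rw [this, map_smul, smul_eq_mul, Pi.mul_apply]
  have hdF' : HasDerivAt (fun s => fderiv ℝ F (H ustar s)) (fderiv ℝ (fderiv ℝ F) ustar e) 0 := by
    refine HasFDerivAt.comp_hasDerivAt (l := fderiv ℝ F) (f := H ustar) 0 ?_ hH1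
    rw [hH0]; exact hdF.hasFDerivAt
  have hdG' : HasDerivAt (fun s => fderiv ℝ G (H ustar s)) (fderiv ℝ (fderiv ℝ G) ustar e) 0 := by
    refine HasFDerivAt.comp_hasDerivAt (l := fderiv ℝ G) (f := H ustar) 0 ?_ hH1
    rw [hH0]; exact hdG.hasFDerivAt
  have h1 := N.hasFDerivAt.comp_hasDerivAt 0 (hdF'.clm_apply ha)
  have h2 := (hb.mul (hcomp hG).self_of_nhds).add
    (hσev.self_of_nhds.mul (N.hasFDerivAt.comp_hasDerivAt 0 (hdG'.clm_apply ha)))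
  have h3 := (h1.congr_of_eventuallyEq (EventuallyEq.symm hRH')).unique h2
  simp only [hH0, hH'0, map_add, hNF, add_zero, sub_self, map_zero, mul_zero, zero_add,
    Function.comp_apply, hσ0, zero_mul, hI] at h3
  have h4 : (2 * σ' (ustar, 0) - fderiv ℝ (lam k) ustar e) * N (fderiv ℝ G ustar e) = 0 := by
    linarith
  have := (mul_eq_zero.1 h4).resolve_right hNG.ne'
  linarith

end ViscousSystem

/-! ### The center manifold and the conserved flux -/

namespace ViscousSystem

variable {h m : ℕ} {S : ViscousSystem h m}
variable {ustar : State h m} {W : Set (State h m × ℝ)} {p : State h m × ℝ → Par m}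

theorem lift_smul (u : State h m) (z : ℝ) (x : Par m) : S.lift u (z • x) = z • S.lift u x := by
  ext j
  cases j with
  | inl j => simp [lift, joinState, Matrix.mulVec_smul]
  | inr j => simp [lift, joinState]

/-- The denominator in the definition of `thetac`. -/
noncomputable def thetacDenom (S : ViscousSystem h m) (p : State h m × ℝ → Par m) (w : State h m × ℝ) : ℝ :=
  1 + w.2 * ((p w).ofLp ⬝ᵥ (S.B22 w.1 *ᵥ (fderiv ℝ p w (0, 1))))

theorem contDiffAt_thetacDenom (hS : S.IsNormalForm) (hp : S.IsCenterManifold ustar W p)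
    {w : State h m × ℝ} (hw : w ∈ W) : ContDiffAt ℝ 1 (thetacDenom S p) w := by
  have hpd : ContDiffAt ℝ 1 p w :=
    (hp.regular.contDiffAt (hp.isOpen.mem_nhds hw)).of_le (by norm_num)
  have hdp : ContDiffAt ℝ 1 (fderiv ℝ p) w := (contDiffAt_fderiv_p hp hw).of_le (by norm_num)
  exact contDiffAt_const.add (contDiffAt_snd.mul (contDiffAt_dotProduct (contDiffAt_coord hpd)
    (contDiffAt_mulVec_B22 hS (n := 1) contDiffAt_fst (hdp.clm_apply contDiffAt_const)
      (hp.fst_mem w hw))))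

theorem eventually_thetacDenom_pos (hS : S.IsNormalForm) (hp : S.IsCenterManifold ustar W p) :
    ∀ᶠ w in 𝓝 (ustar, (0 : ℝ)), 0 < thetacDenom S p w :=
  (contDiffAt_thetacDenom hS hp hp.base_mem).continuousAt.eventually
    (lt_mem_nhds (by simp [thetacDenom]))

/-- A curve on the center manifold that starts close to the equilibrium and off the plane `z = 0`
admits a differentiable coordinate `z`. -/
theorem exists_hasDerivAt_coordinate (hS : S.IsNormalForm) (hp : S.IsCenterManifold ustar W p)
    {δ : ℝ} (hδW : Metric.ball (ustar, (0 : ℝ)) δ ⊆ W)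
    (hδp : ∀ w ∈ Metric.ball (ustar, (0 : ℝ)) δ, 0 < inner ℝ (p (ustar, 0)) (p w))
    {w₀ : State h m × ℝ} (hw₀ : w₀ ∈ Metric.ball (ustar, (0 : ℝ)) δ) (hz : w₀.2 ≠ 0)
    {c : ℝ → State h m × Par m} {a : State h m} {b : Par m} (hc0 : c 0 = (w₀.1, w₀.2 • p w₀))
    (hc : HasDerivAt c (a, b) 0) (hcS : ∀ᶠ x in 𝓝 (0 : ℝ), c x ∈ centerSet W p) :
    ∃ (Z : ℝ → ℝ) (z' : ℝ), HasDerivAt Z z' 0 ∧ Z 0 = w₀.2 ∧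
      ∀ᶠ x in 𝓝 (0 : ℝ), (c x).2 = Z x • p ((c x).1, Z x) := by
  obtain ⟨u₀, z₀⟩ := w₀
  simp only at hz hc0 ⊢
  have hu₀ : u₀ ∈ S.U := hp.fst_mem _ (hδW hw₀)
  have hfst : HasDerivAt (fun x => (c x).1) a 0 := hc.fst
  have hsnd : HasDerivAt (fun x => (c x).2) b 0 := hc.snd
  have hc01 : (c 0).1 = u₀ := by rw [hc0]
  have hc02 : (c 0).2 = z₀ • p (u₀, z₀) := by rw [hc0]
  -- The normalization of `p` turns this form into `z²` on the center manifold, so `z = ±√Qf`, which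
  -- is differentiable away from `z = 0`.
  set Qf : State h m × Par m → ℝ := fun v => v.2.ofLp ⬝ᵥ (S.B22 v.1 *ᵥ v.2)
  have hscale : ∀ w ∈ W, Qf (w.1, w.2 • p w) = w.2 ^ 2 := fun w hw => by
    simp only [Qf, WithLp.ofLp_smul, Matrix.mulVec_smul, dotProduct_smul, smul_dotProduct,
      hp.normalized w hw, smul_eq_mul]
    ring
  have hQd : DifferentiableAt ℝ Qf (c 0) := by
    have : ContDiffAt ℝ 1 Qf (c 0) := contDiffAt_dotProduct (contDiffAt_coord contDiffAt_snd)
      (contDiffAt_mulVec_B22 hS (n := 1) contDiffAt_fst contDiffAt_snd (by rw [hc01]; exact hu₀))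
    exact this.differentiableAt (by norm_num)
  have hQ0 : Qf (c 0) = z₀ ^ 2 := by rw [hc0]; exact hscale _ (hδW hw₀)
  have hQc : HasDerivAt (fun x => Qf (c x)) (fderiv ℝ Qf (c 0) (a, b)) 0 :=
    hQd.hasFDerivAt.comp_hasDerivAt 0 hc
  have hQs := hQc.sqrt (by rw [hQ0]; positivity)
  rw [Metric.mem_ball, Prod.dist_eq, max_lt_iff, Real.dist_eq, sub_zero] at hw₀
  have hnear1 : ∀ᶠ x in 𝓝 (0 : ℝ), dist (c x).1 ustar < δ := by
    refine hfst.continuousAt.eventually (Metric.isOpen_ball.mem_nhds ?_)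
    simpa only [hc01, Metric.mem_ball] using hw₀.1
  -- Membership in `centerSet` yields some `(u, ζ) ∈ W`, a priori far from the base point. This
  -- bound forces `|ζ| < δ`, where `p` has positive product with `p(u*, 0)`; `hsign` then fixes the
  -- sign of `ζ`.
  have hnear2 : ∀ᶠ x in 𝓝 (0 : ℝ), Qf (c x) < δ ^ 2 := by
    refine hQc.continuousAt.eventually (gt_mem_nhds ?_)
    change Qf (c 0) < δ ^ 2
    rw [hQ0]
    exact sq_lt_sq' (by linarith [neg_abs_le z₀]) ((le_abs_self _).trans_lt hw₀.2)
  have hsign : ∀ᶠ x in 𝓝 (0 : ℝ), 0 < z₀ * inner ℝ (p (ustar, 0)) (c x).2 := by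
    have hcont : ContinuousAt (fun x => z₀ * inner ℝ (p (ustar, 0)) (c x).2) 0 :=
      continuousAt_const.mul (continuousAt_const.inner hsnd.continuousAt)
    refine hcont.eventually (lt_mem_nhds ?_)
    have := hδp (u₀, z₀) (by
      rw [Metric.mem_ball, Prod.dist_eq, max_lt_iff, Real.dist_eq, sub_zero]; exact hw₀)
    change 0 < z₀ * inner ℝ (p (ustar, 0)) (c 0).2
    rw [hc02, inner_smul_right, ← mul_assoc]
    exact mul_pos (mul_self_pos.2 hz) this
  refine ⟨fun x => z₀ / |z₀| * √(Qf (c x)), _, hQs.const_mul (z₀ / |z₀|), ?_, ?_⟩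
  · change z₀ / |z₀| * √(Qf (c 0)) = z₀
    rw [hQ0, Real.sqrt_sq_eq_abs, div_mul_cancel₀ _ (abs_ne_zero.2 hz)]
  · filter_upwards [hcS, hnear1, hnear2, hsign] with x hx h1 h2 h3
    obtain ⟨⟨u, ζ⟩, hw, hcx⟩ := hx
    have hcx1 : (c x).1 = u := by rw [← hcx]
    have hcx2 : (c x).2 = ζ • p (u, ζ) := by rw [← hcx]
    have hQx : Qf (c x) = ζ ^ 2 := by rw [← hcx]; exact hscale _ hw
    rw [hQx] at h2
    have hζ : |ζ| < δ := abs_lt_of_sq_lt_sq h2 ((abs_nonneg _).trans hw₀.2.le)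
    have hpos := hδp (u, ζ) (by
      rw [Metric.mem_ball, Prod.dist_eq, max_lt_iff, Real.dist_eq, sub_zero]
      exact ⟨by rwa [← hcx1], hζ⟩)
    rw [hcx2, inner_smul_right, ← mul_assoc] at h3
    have hzζ : 0 < z₀ * ζ := pos_of_mul_pos_left h3 hpos.le
    have hZ : z₀ / |z₀| * √(Qf (c x)) = ζ := by
      rw [hQx, Real.sqrt_sq_eq_abs]
      rcases lt_or_gt_of_ne hz with hneg | hpos'
      · rw [abs_of_neg hneg, abs_of_neg (by nlinarith : ζ < 0)]
        field_simp
      · rw [abs_of_pos hpos', abs_of_pos (by nlinarith : 0 < ζ)]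
        field_simp
    rw [hZ, hcx2, hcx1]

/-- The invariance relation satisfied by the parametrization of the center manifold. -/
theorem eventually_invariance (hS : S.IsNormalForm) (hA : ∀ u ∈ S.U, (S.A11 u).det ≠ 0)
    (hp : S.IsCenterManifold ustar W p) : ∀ᶠ w in 𝓝 (ustar, (0 : ℝ)),
      S.blMatrix w.1 (w.2 • S.rc p w) *ᵥ p w = S.thetac p w • (S.B22 w.1 *ᵥ p w) +
        w.2 • (S.B22 w.1 *ᵥ (fderiv ℝ p w (S.rc p w, S.thetac p w))) := by
  have hpc : ContinuousAt p (ustar, 0) :=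
    (hp.regular.contDiffAt (hp.isOpen.mem_nhds hp.base_mem)).continuousAt
  have hinner : ∀ᶠ w in 𝓝 (ustar, (0 : ℝ)), 0 < inner ℝ (p (ustar, 0)) (p w) :=
    (continuousAt_const.inner hpc).eventually (lt_mem_nhds (real_inner_self_pos.2 hp.ne_zero))
  obtain ⟨δ, hδ, hball⟩ := Metric.eventually_nhds_iff_ball.1
    ((hp.isOpen.eventually_mem hp.base_mem).and (hinner.and (eventually_thetacDenom_pos hS hp)))
  -- A trajectory on the manifold has second component `Z p(·, Z)`. Differentiating it and comparing
  -- with `blField` gives the relation multiplied by `z`, which can be cancelled off the plane `z =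
  -- 0`.
  have hoff : ∀ w ∈ Metric.ball (ustar, (0 : ℝ)) δ, w.2 ≠ 0 →
      S.blMatrix w.1 (w.2 • S.rc p w) *ᵥ p w = S.thetac p w • (S.B22 w.1 *ᵥ p w) +
        w.2 • (S.B22 w.1 *ᵥ (fderiv ℝ p w (S.rc p w, S.thetac p w))) := by
    intro w hw hz
    obtain ⟨hwW, -, hden⟩ := hball w hw
    obtain ⟨ε, hε, c, hc0, hc⟩ := hp.invariant (w.1, w.2 • p w) ⟨w, hwW, rfl⟩
    have hc' := (hc 0 ⟨by linarith, hε⟩).2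
    rw [hc0, blField] at hc'
    obtain ⟨Z, z', hZ, hZ0, hcZ⟩ := exists_hasDerivAt_coordinate hS hp
      (fun v hv => (hball v hv).1) (fun v hv => (hball v hv).2.1) hw hz hc0 hc'
      (by filter_upwards [Ioo_mem_nhds (by linarith : -ε < 0) hε] with x hx using (hc x hx).1)
    have hpd : HasFDerivAt p (fderiv ℝ p w) w :=
      ((hp.regular.contDiffAt (hp.isOpen.mem_nhds hwW)).differentiableAt
        (by norm_num)).hasFDerivAt
    have hfst : HasDerivAt (fun x => (c x).1) (S.lift w.1 (w.2 • p w)) 0 := hc'.fst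
    have hsnd : HasDerivAt (fun x => (c x).2) (WithLp.toLp 2 ((S.B22 w.1)⁻¹ *ᵥ
        (S.blMatrix w.1 (S.lift w.1 (w.2 • p w)) *ᵥ (w.2 • p w).ofLp))) 0 := hc'.snd
    have hcurve := hfst.prodMk hZ
    have hpc : HasDerivAt (fun x => p ((c x).1, Z x))
        (fderiv ℝ p w (S.lift w.1 (w.2 • p w), z')) 0 := by
      refine HasFDerivAt.comp_hasDerivAt (l := p) 0 ?_ hcurve
      rw [hc0, hZ0]; exact hpd
    have h1 := hsnd.unique ((hZ.smul hpc).congr_of_eventuallyEq hcZ)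
    rw [hc0, hZ0, lift_smul] at h1
    have hB : IsUnit (S.B22 w.1).det :=
      (Matrix.isUnit_iff_isUnit_det _).1 (hS.B22_posDef _ (hp.fst_mem w hwW)).isUnit
    have h2 : w.2 • (S.blMatrix w.1 (w.2 • S.rc p w) *ᵥ p w) =
        z' • (S.B22 w.1 *ᵥ p w) +
          w.2 • (S.B22 w.1 *ᵥ (fderiv ℝ p w (w.2 • S.rc p w, z'))) := by
      have := congrArg (fun v : Par m => S.B22 w.1 *ᵥ v.ofLp) h1
      simp only [Matrix.mulVec_mulVec, WithLp.ofLp_add, WithLp.ofLp_smul, Matrix.mulVec_add, Matrix.mulVec_smul,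
        Matrix.mul_nonsing_inv_cancel_left _ _ hB] at this
      rw [add_comm] at this
      exact this
    have hlin : ∀ a b : ℝ, fderiv ℝ p w (a • S.rc p w, b) =
        a • fderiv ℝ p w (S.rc p w, 0) + b • fderiv ℝ p w (0, 1) := fun a b => by
      rw [← map_smul, ← map_smul, ← map_add]
      simp
    -- Pairing with `p` and using its normalization gives a scalar linear equation for `z'`; its
    -- solution is the formula defining `thetac`, times `z`.
    have h3 : z' = w.2 * S.thetac p w := by
      have := congrArg (fun v => (p w).ofLp ⬝ᵥ v) h2
      simp only [hlin, dotProduct_add, dotProduct_smul, hp.normalized w hwW, smul_eq_mul,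
        WithLp.ofLp_add, WithLp.ofLp_smul, Matrix.mulVec_add, Matrix.mulVec_smul] at this
      rw [thetacDenom] at hden
      rw [thetac, mul_div_assoc', eq_div_iff hden.ne']
      linarith
    have h4 : (w.2 • S.rc p w, z') = w.2 • (S.rc p w, S.thetac p w) := by
      rw [h3]; rfl
    rw [h4, map_smul, h3, WithLp.ofLp_smul, Matrix.mulVec_smul, mul_smul, ← smul_add] at h2
    exact smul_right_injective _ hz h2
  refine Metric.eventually_nhds_iff_ball.2 ⟨δ, hδ, fun w hw => ?_⟩
  obtain ⟨u, z⟩ := w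
  by_cases hz : z = 0
  swap
  · exact hoff _ hw hz
  subst hz
  have hwW := (hball _ hw).1
  have hu := hp.fst_mem _ hwW
  have hpd : ContDiffAt ℝ 1 p (u, 0) :=
    (hp.regular.contDiffAt (hp.isOpen.mem_nhds hwW)).of_le (by norm_num)
  have hdp : ContDiffAt ℝ 1 (fderiv ℝ p) (u, 0) :=
    (contDiffAt_fderiv_p hp hwW).of_le (by norm_num)
  have hrc : ContDiffAt ℝ 1 (S.rc p) (u, 0) := (contDiffAt_rc hS hA hp hwW).of_le (by norm_num)
  have hth : ContDiffAt ℝ 1 (S.thetac p) (u, 0) :=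
    contDiffAt_thetac hS hA hp hwW (hball _ hw).2.2.ne'
  -- On the plane `z = 0` the relation follows by continuity of both sides, letting `t → 0` along
  -- `(u, t)`.
  have hline : Tendsto (fun t : ℝ => (u, t)) (𝓝[≠] 0) (𝓝 (u, 0)) :=
    (by fun_prop : ContinuousAt (fun t : ℝ => (u, t)) 0).tendsto.mono_left nhdsWithin_le_nhds
  have hB := fun (q : State h m × ℝ → Par m) (hq : ContDiffAt ℝ 1 q (u, 0)) (j : Fin m) =>
    contDiffAt_mulVec_B22 hS (n := 1) (a := Prod.fst) contDiffAt_fst hq hu j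
  ext j
  have c1 : ContDiffAt ℝ 1 (fun w : State h m × ℝ =>
      (S.blMatrix w.1 (w.2 • S.rc p w) *ᵥ p w) j) (u, 0) :=
    contDiffAt_mulVec (contDiffAt_blMatrix hS hA (n := 1) contDiffAt_fst
      (contDiffAt_snd.smul hrc) hu) (contDiffAt_coord hpd) j
  have c2 : ContDiffAt ℝ 1 (fun w : State h m × ℝ => S.thetac p w * (S.B22 w.1 *ᵥ p w) j +
      w.2 * (S.B22 w.1 *ᵥ (fderiv ℝ p w (S.rc p w, S.thetac p w))) j) (u, 0) :=
    (hth.mul (hB _ hpd j)).add (contDiffAt_snd.mul (hB _ (hdp.clm_apply (hrc.prodMk hth)) j))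
  refine tendsto_nhds_unique (c1.continuousAt.tendsto.comp hline)
    ((c2.continuousAt.tendsto.comp hline).congr' ?_)
  have hin : ∀ᶠ t in 𝓝[≠] (0 : ℝ), (u, t) ∈ Metric.ball (ustar, (0 : ℝ)) δ :=
    hline.eventually (Metric.isOpen_ball.mem_nhds hw)
  filter_upwards [hin, self_mem_nhdsWithin] with t ht ht0
  exact (congrFun (hoff _ ht ht0) j).symm

/-! ### Conservation of the total flux on the center manifold. -/

/-- The projection on the last `m` components, as a continuous linear map. -/
noncomputable def parPartL : State h m →L[ℝ] Par m :=
  LinearMap.toContinuousLinearMap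
    { toFun := parPart
      map_add' := fun _ _ => rfl
      map_smul' := fun _ _ => rfl }

theorem fderiv_p_eq (hS : S.IsNormalForm) (hA : ∀ u ∈ S.U, (S.A11 u).det ≠ 0)
    (hp : S.IsCenterManifold ustar W p) {w : State h m × ℝ} (hw : w ∈ W) (x : State h m × ℝ) :
    fderiv ℝ p w x = parPart (fderiv ℝ (S.rc p) w x) := by
  have h1 : HasFDerivAt p (parPartL.comp (fderiv ℝ (S.rc p) w)) w :=
    (parPartL (h := h) (m := m)).hasFDerivAt.comp w
      ((contDiffAt_rc hS hA hp hw).differentiableAt (by norm_num)).hasFDerivAt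
  rw [h1.fderiv]
  rfl

theorem B_mulVec (hS : S.IsNormalForm) {u : State h m} (hu : u ∈ S.U) (x : State h m) :
    S.B u *ᵥ x.ofLp =
      (joinState 0 (WithLp.toLp 2 (S.B22 u *ᵥ parPart x)) : State h m).ofLp := by
  have h1 : x.ofLp = Sum.elim (hypPart x) (parPart x).ofLp := by
    ext j; cases j <;> rfl
  obtain ⟨b1, b2, b3⟩ := hS.B_block u hu
  conv_lhs => rw [← Matrix.fromBlocks_toBlocks (S.B u), b1, b2, b3, h1, Matrix.fromBlocks_mulVec]
  simp [joinState, B22]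

theorem joinState_smul (z : ℝ) (x : Fin h → ℝ) (q : Par m) :
    joinState (z • x) (z • q) = z • joinState x q := by
  ext j; cases j <;> rfl

/-- The rewriting identifies `gTerm u q` with `M (D visc(u) q q)`, which is quadratic in `q`. Hence
`G(u, z q) (z q) = z² G(u, q) q`, and one factor `z` cancels; at `z = 0` both sides vanish. -/
theorem smul_gTerm (hS : S.IsNormalForm) {u : State h m} (hu : u ∈ S.U) (z : ℝ)
    (q : State h m) : z • S.gTerm u q = joinState 0 (WithLp.toLp 2
      (S.G₁ u (parPart (z • q)) *ᵥ hypPart q + S.G₂ u (z • q) *ᵥ parPart q)) := by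
  by_cases hz : z = 0
  · subst hz
    have h0 : parPart (0 : State h m) = 0 := rfl
    simp only [zero_smul, h0, hS.G₁_zero u hu, hS.G₂_zero u hu, Matrix.zero_mulVec, add_zero]
    ext j; cases j <;> rfl
  · obtain ⟨M, -, -, -, hG⟩ := hS.rewriting u hu
    have h1 : S.gTerm u (z • q) = z • z • S.gTerm u q := by
      rw [← hG, ← hG, map_smul, map_smul, map_smul, smul_apply, map_smul]
    have h2 : S.gTerm u (z • q) = z • joinState 0 (WithLp.toLp 2
        (S.G₁ u (parPart (z • q)) *ᵥ hypPart q + S.G₂ u (z • q) *ᵥ parPart q)) := by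
      have h3 : hypPart (z • q) = z • hypPart q := rfl
      have h4 : (parPart (z • q)).ofLp = z • (parPart q).ofLp := rfl
      conv_lhs => rw [gTerm, h3, h4, Matrix.mulVec_smul, Matrix.mulVec_smul, ← smul_add,
        WithLp.toLp_smul]
      rw [← joinState_smul, smul_zero]
    exact smul_right_injective _ hz (h1.symm.trans h2)

/-- The total flux `f(v) - D(v) v_x` on the center manifold. -/
noncomputable def totalFlux (S : ViscousSystem h m) (p : State h m × ℝ → Par m) (w : State h m × ℝ) :
    State h m :=
  (S.f ∘ S.v) w.1 - w.2 • S.visc w.1 (S.rc p w)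

theorem contDiffAt_visc (hS : S.IsNormalForm) {u : State h m} (hu : u ∈ S.U) :
    ContDiffAt ℝ 1 S.visc u :=
  ((contDiffAt_comp_v hS hS.smooth_D hu).of_le (by simp)).clm_comp
    ((hS.smooth_v.contDiffAt (hS.isOpen_U.mem_nhds hu)).fderiv_right (by norm_cast))

/-- The total flux is constant along the reduced boundary layer system. -/
theorem hasFDerivAt_totalFlux (hS : S.IsNormalForm) (hA : ∀ u ∈ S.U, (S.A11 u).det ≠ 0)
    (hp : S.IsCenterManifold ustar W p) {w : State h m × ℝ} (hw : w ∈ W)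
    (hinv : S.blMatrix w.1 (w.2 • S.rc p w) *ᵥ p w = S.thetac p w • (S.B22 w.1 *ᵥ p w) +
        w.2 • (S.B22 w.1 *ᵥ (fderiv ℝ p w (S.rc p w, S.thetac p w)))) :
    ∃ T : State h m × ℝ →L[ℝ] State h m, HasFDerivAt (totalFlux S p) T w ∧
      T (S.rc p w, S.thetac p w) = 0 := by
  obtain ⟨u, z⟩ := w
  have hu : u ∈ S.U := hp.fst_mem _ hw
  obtain ⟨M, -, hMA, hMB, hMG⟩ := hS.rewriting u hu
  have hF : HasFDerivAt (S.f ∘ S.v) (fderiv ℝ (S.f ∘ S.v) u) u :=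
    ((contDiffAt_comp_v hS hS.smooth_f hu).differentiableAt (by simp)).hasFDerivAt
  have hV : HasFDerivAt S.visc (fderiv ℝ S.visc u) u :=
    ((contDiffAt_visc hS hu).differentiableAt (by norm_num)).hasFDerivAt
  have hrc : HasFDerivAt (S.rc p) (fderiv ℝ (S.rc p) (u, z)) (u, z) :=
    ((contDiffAt_rc hS hA hp hw).differentiableAt (by norm_num)).hasFDerivAt
  have hfst := hasFDerivAt_fst (𝕜 := ℝ) (p := (u, z))
  have hsnd := hasFDerivAt_snd (𝕜 := ℝ) (p := (u, z))
  refine ⟨_, (hF.comp (u, z) hfst).sub (hsnd.smul ((hV.comp (u, z) hfst).clm_apply hrc)), ?_⟩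
  apply M.injective
  rw [map_zero]
  set R := S.rc p (u, z) with hR
  set θ := S.thetac p (u, z)
  have hpar : parPart R = p (u, z) := rfl
  have hhyp : hypPart R = -((S.A11 u)⁻¹ *ᵥ ((S.A21 u)ᵀ *ᵥ (p (u, z)).ofLp)) := rfl
  have e0 : ∀ x : State h m × ℝ, M (S.visc u (fderiv ℝ (S.rc p) (u, z) x)) =
      joinState 0 (WithLp.toLp 2 (S.B22 u *ᵥ fderiv ℝ p (u, z) x)) := fun x => by
    rw [hMB, B_mulVec hS hu, fderiv_p_eq hS hA hp hw]
  have e1 : M (S.visc u R) = joinState 0 (WithLp.toLp 2 (S.B22 u *ᵥ p (u, z))) := by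
    rw [hMB, B_mulVec hS hu, hpar]
  have e2 : M (fderiv ℝ (S.f ∘ S.v) u R) = joinState 0 (WithLp.toLp 2
      ((S.A22 u - S.A21 u * (S.A11 u)⁻¹ * (S.A21 u)ᵀ) *ᵥ p (u, z))) := by
    rw [hMA, hR, rc, A_mulVec_lift hS hA hu]
  have e3 : z • M (fderiv ℝ S.visc u R R) = joinState 0 (WithLp.toLp 2
      (S.G₁ u (parPart (z • R)) *ᵥ hypPart R + S.G₂ u (z • R) *ᵥ parPart R)) := by
    rw [hMG, smul_gTerm hS hu]
  have hbl : S.blMatrix u (z • R) *ᵥ (p (u, z)).ofLp =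
      (S.A22 u - S.A21 u * (S.A11 u)⁻¹ * (S.A21 u)ᵀ) *ᵥ (p (u, z)).ofLp -
        (S.G₁ u (parPart (z • R)) *ᵥ hypPart R + S.G₂ u (z • R) *ᵥ (p (u, z)).ofLp) := by
    rw [hhyp, blMatrix]
    simp only [Matrix.sub_mulVec, Matrix.add_mulVec, Matrix.sub_mul, Matrix.mulVec_neg,
      Matrix.mulVec_mulVec, Matrix.mul_assoc]
    abel
  -- After multiplication by `M`, the derivative of the flux along the reduced field has zero
  -- hyperbolic block, and its parabolic block is the invariance relation.
  have e4 : M (fderiv ℝ (S.f ∘ S.v) u R) - (θ • M (S.visc u R) +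
      z • M (S.visc u (fderiv ℝ (S.rc p) (u, z) (R, θ))) + z • M (fderiv ℝ S.visc u R R)) = 0 := by
    rw [e0, e1, e2, e3, hpar]
    ext j
    cases j with
    | inl j => simp [joinState]
    | inr j =>
      have h1 := congrFun (hbl.symm.trans hinv) j
      simp only [Pi.sub_apply, Pi.add_apply, Pi.smul_apply, smul_eq_mul] at h1
      simp only [joinState, PiLp.sub_apply, PiLp.add_apply, PiLp.smul_apply, Sum.elim_inr,
        smul_eq_mul, PiLp.zero_apply, Pi.add_apply]
      linarith
  rw [← e4]
  simp [R, θ]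
  abel

end ViscousSystem

/-! ### Comparison of the curves -/

/-- Two solutions of different autonomous equations with the same initial value. -/
theorem norm_sub_le_of_two_fields {F : Type*} [NormedAddCommGroup F] [NormedSpace ℝ F]
    {X₁ X₂ : F → F} {B : Set F} {K L : ℝ} (hL : 0 ≤ L)
    (hK₁ : ∀ w ∈ B, ‖X₁ w‖ ≤ K) (hK₂ : ∀ w ∈ B, ‖X₂ w‖ ≤ K)
    (hL₁ : ∀ w ∈ B, ∀ w' ∈ B, ‖X₁ w - X₁ w'‖ ≤ L * ‖w - w'‖)
    (hL₂ : ∀ w ∈ B, ∀ w' ∈ B, ‖X₂ w - X₂ w'‖ ≤ L * ‖w - w'‖) {α β : ℝ → F} {s : ℝ}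
    (hα : ∀ t ∈ uIcc 0 s, α t ∈ B ∧ HasDerivAt α (X₁ (α t)) t)
    (hβ : ∀ t ∈ uIcc 0 s, β t ∈ B ∧ HasDerivAt β (X₂ (β t)) t) (h0 : α 0 = β 0) :
    ‖α s - β s‖ ≤ (‖X₁ (α 0) - X₂ (α 0)‖ + 2 * L * K * |s|) * |s| := by
  have hJ : Convex ℝ (uIcc 0 s) := convex_uIcc 0 s
  have m0 : (0 : ℝ) ∈ uIcc 0 s := left_mem_uIcc
  have ms : s ∈ uIcc 0 s := right_mem_uIcc
  have hK0 : 0 ≤ K := (norm_nonneg _).trans (hK₁ _ (hα 0 m0).1)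
  have habs : ∀ t ∈ uIcc 0 s, |t - 0| ≤ |s| := fun t ht => by
    simpa using abs_sub_left_of_mem_uIcc ht
  have hα' : ∀ t ∈ uIcc 0 s, ‖α t - α 0‖ ≤ K * |s| := fun t ht =>
    (norm_image_sub_le_of_hasDerivAt hJ (fun t ht => (hα t ht).2)
      (fun t ht => hK₁ _ (hα t ht).1) ht m0).trans
      (mul_le_mul_of_nonneg_left (habs t ht) hK0)
  have hβ' : ∀ t ∈ uIcc 0 s, ‖β t - β 0‖ ≤ K * |s| := fun t ht =>
    (norm_image_sub_le_of_hasDerivAt hJ (fun t ht => (hβ t ht).2)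
      (fun t ht => hK₂ _ (hβ t ht).1) ht m0).trans
      (mul_le_mul_of_nonneg_left (habs t ht) hK0)
  have hD : ∀ t ∈ uIcc 0 s, ‖X₁ (α t) - X₂ (β t)‖ ≤
      ‖X₁ (α 0) - X₂ (α 0)‖ + 2 * L * K * |s| := by
    intro t ht
    -- No Gronwall argument is needed: each curve has moved by at most `K |s|`, so each velocity is
    -- within `L K |s|` of its initial value.
    have e : X₁ (α t) - X₂ (β t) = (X₁ (α 0) - X₂ (α 0)) + ((X₁ (α t) - X₁ (α 0)) -
        (X₂ (β t) - X₂ (β 0))) := by rw [h0]; abel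
    have e1 := (hL₁ _ (hα t ht).1 _ (hα 0 m0).1).trans
      (mul_le_mul_of_nonneg_left (hα' t ht) hL)
    have e2 := (hL₂ _ (hβ t ht).1 _ (hβ 0 m0).1).trans
      (mul_le_mul_of_nonneg_left (hβ' t ht) hL)
    rw [e]
    linarith [norm_add_le (X₁ (α 0) - X₂ (α 0)) ((X₁ (α t) - X₁ (α 0)) - (X₂ (β t) - X₂ (β 0))),
      norm_sub_le (X₁ (α t) - X₁ (α 0)) (X₂ (β t) - X₂ (β 0))]
  have := norm_image_sub_le_of_hasDerivAt hJ (fun t ht => (hα t ht).2.sub (hβ t ht).2) hD ms m0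
  simpa [h0] using this

/-- Transfers estimates from the coordinates `(u, z)` to the phase space `(u, z p)`, at the cost of
the factor `1 + P`. -/
theorem norm_sub_layerCurve_le {h m : ℕ} {p : State h m × ℝ → Par m}
    {y : State h m → ℝ → State h m × ℝ} {u x : State h m} {s P : ℝ} (hP : 0 ≤ P)
    (hp : ‖p (y u s)‖ ≤ P) :
    ‖((x, 0) : State h m × Par m) - layerCurve p y u s‖ ≤
      (1 + P) * ‖((x, 0) : State h m × ℝ) - y u s‖ := by
  have h1 : ‖x - (y u s).1‖ ≤ ‖((x, 0) : State h m × ℝ) - y u s‖ := by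
    simpa using norm_fst_le (((x, 0) : State h m × ℝ) - y u s)
  have h2 : |(y u s).2| ≤ ‖((x, 0) : State h m × ℝ) - y u s‖ := by
    simpa using norm_snd_le (((x, 0) : State h m × ℝ) - y u s)
  have h0 := norm_nonneg (((x, 0) : State h m × ℝ) - y u s)
  rw [layerCurve, Prod.mk_sub_mk, Prod.norm_mk, zero_sub, norm_neg, norm_smul, Real.norm_eq_abs]
  refine max_le (by nlinarith) ?_
  calc |(y u s).2| * ‖p (y u s)‖ ≤ ‖((x, 0) : State h m × ℝ) - y u s‖ * P := by gcongr
    _ ≤ _ := by nlinarith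

set_option maxHeartbeats 1000000 in
/-- The estimate between the two curves, from uniform properties of the rarefaction, Hugoniot and
boundary layer curves. -/
theorem exists_norm_sub_gammaCurve_le {h m : ℕ} {ustar : State h m} {lamk : State h m → ℝ}
    {r : State h m → State h m} {X : State h m × ℝ → State h m × ℝ}
    {p : State h m × ℝ → Par m} {i H H' : State h m → ℝ → State h m}
    {σ σ' l : State h m → ℝ → ℝ} {y : State h m → ℝ → State h m × ℝ}
    {B : Set (State h m × ℝ)} {K L P c ρ η : ℝ} (hK : 0 ≤ K) (hL : 0 ≤ L) (hP : 0 ≤ P)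
    (hc : 0 < c) (hρ : 0 < ρ) (hρη : 2 * ρ ≤ η)
    (hlam : ContinuousAt lamk ustar) (hlam0 : lamk ustar = 0)
    (hrK : ∀ w ∈ B, ‖((r w.1, 0) : State h m × ℝ)‖ ≤ K) (hXK : ∀ w ∈ B, ‖X w‖ ≤ K)
    (hrL : ∀ w ∈ B, ∀ w' ∈ B,
      ‖((r w.1, 0) : State h m × ℝ) - (r w'.1, 0)‖ ≤ L * ‖w - w'‖)
    (hXL : ∀ w ∈ B, ∀ w' ∈ B, ‖X w - X w'‖ ≤ L * ‖w - w'‖)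
    (hpP : ∀ w ∈ B, ‖p w‖ ≤ P)
    (hi : ∀ u ∈ Metric.ball ustar η, i u 0 = u ∧ ∀ s ∈ Ioo (-η) η, (i u s, (0 : ℝ)) ∈ B ∧
      HasDerivAt (i u) (r (i u s)) s ∧ HasDerivAt (fun s => lamk (i u s)) (l u s) s ∧ c ≤ l u s)
    (hiη : ∀ u ∈ Metric.ball ustar ρ, ∀ s ∈ Ioo (-ρ) ρ, i u s ∈ Metric.ball ustar η)
    (hy : ∀ u ∈ Metric.ball ustar η, y u 0 = (u, 0) ∧ ∀ s ∈ Ioo (-η) η, y u s ∈ B ∧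
      HasDerivAt (y u) (X (y u s)) s)
    (hH : ∀ u ∈ Metric.ball ustar η, H u 0 = u ∧ ∀ s ∈ Ioo (-η) η,
      HasDerivAt (H u) (H' u s) s ∧ ∀ t ∈ Ioo (-η) η, ‖H' u s - H' u t‖ ≤ L * |s - t|)
    (hσ : ∀ u ∈ Metric.ball ustar η, σ u 0 = lamk u ∧ ∀ s ∈ Ioo (-η) η,
      HasDerivAt (σ u) (σ' u s) s ∧ c ≤ σ' u s)
    (hmatch : ∀ u ∈ Metric.ball ustar η, lamk u < 0 → ∀ s ∈ Ioo 0 η, σ u s = 0 →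
      y u s = (H u s, 0))
    (hvanish : ∀ u ∈ Metric.ball ustar η, lamk u = 0 → X (u, 0) = (r u, 0)) :
    ∃ C ν : ℝ, 0 < C ∧ 0 < ν ∧ ∀ u : State h m, ‖u - ustar‖ ≤ ν →
      (∃! s, s ∈ Ioo (-ρ) ρ ∧ σ u s = 0) ∧
      (∃! s, s ∈ Ioo (-ρ) ρ ∧ lamk (i u s) = 0) ∧
      ∀ s ∈ Ioo (-ν) ν,
        ‖((laxCurve i H u s, 0) : State h m × Par m) - gammaCurve ρ lamk i H σ p y u s‖
          ≤ C * |s| * max (-(waveSpeed lamk i H σ u s)) 0 := by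
  have hcρ : 0 < c * ρ := mul_pos hc hρ
  obtain ⟨ν₁, hν₁, hsmall⟩ := Metric.eventually_nhds_iff_ball.1
    (hlam.norm.eventually (gt_mem_nhds (by rwa [hlam0, norm_zero] : ‖lamk ustar‖ < c * ρ)))
  -- `C₁` serves the comparison with rarefactions, `C₂` the comparison with shocks; dividing by `c`
  -- converts a parameter length into a lower bound for the speed.
  set C₁ := 2 * L * K / c with hC₁
  have hC₁0 : 0 ≤ C₁ := by positivity
  have hC₁c : C₁ * c = 2 * L * K := div_mul_cancel₀ _ hc.ne'
  set C₂ := (L + L * K) / c with hC₂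
  have hC₂0 : 0 ≤ C₂ := by positivity
  have hC₂c : C₂ * c = L + L * K := div_mul_cancel₀ _ hc.ne'
  set C := (1 + P) * (2 * C₁ + C₂) + 1 with hCdef
  have hC : 0 < C := by positivity
  have hCC₁ : (1 + P) * C₁ ≤ C := by nlinarith [mul_nonneg hP hC₁0, mul_nonneg hP hC₂0]
  have hCC₂ : (1 + P) * C₂ ≤ C := by nlinarith [mul_nonneg hP hC₁0, mul_nonneg hP hC₂0]
  clear_value C C₁ C₂
  refine ⟨C, min ρ ν₁ / 2, hC, by positivity, fun u hu => ?_⟩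
  have hνρ : min ρ ν₁ / 2 < ρ := by linarith [min_le_left ρ ν₁]
  have huρ : u ∈ Metric.ball ustar ρ := mem_ball_iff_norm.2 (hu.trans_lt hνρ)
  have huη : u ∈ Metric.ball ustar η := Metric.ball_subset_ball (by linarith) huρ
  have hlamu : |lamk u| < c * ρ :=
    hsmall u (mem_ball_iff_norm.2 (hu.trans_lt (by linarith [min_le_right ρ ν₁])))
  have hsub : ∀ s ∈ Ioo (-ρ) ρ, s ∈ Ioo (-η) η := fun s hs =>
    ⟨by linarith [hs.1], by linarith [hs.2]⟩
  obtain ⟨hi0, hi'⟩ := hi u huη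
  obtain ⟨hy0, hy'⟩ := hy u huη
  obtain ⟨hH0, hH'⟩ := hH u huη
  obtain ⟨hσ0, hσ'⟩ := hσ u huη
  have hex1 : ∃! s, s ∈ Ioo (-ρ) ρ ∧ σ u s = 0 := existsUnique_zero_of_hasDerivAt hc
    (fun s hs => (hσ' s (hsub s hs)).1) (fun s hs => (hσ' s (hsub s hs)).2) (by rwa [hσ0])
  have hex2 : ∃! s, s ∈ Ioo (-ρ) ρ ∧ lamk (i u s) = 0 := existsUnique_zero_of_hasDerivAt hc
    (fun s hs => (hi' s (hsub s hs)).2.2.1) (fun s hs => (hi' s (hsub s hs)).2.2.2)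
    (by rwa [hi0])
  refine ⟨hex1, hex2, fun s hs => ?_⟩
  have hsρ : s ∈ Ioo (-ρ) ρ := ⟨by linarith [hs.1], by linarith [hs.2]⟩
  have h0ρ : (0 : ℝ) ∈ Ioo (-ρ) ρ := ⟨by linarith, hρ⟩
  obtain ⟨hs₁, hσs₁⟩ := zeroIn_spec hex1.exists
  obtain ⟨hs₂, hls₂⟩ := zeroIn_spec hex2.exists
  change sUnder ρ σ u ∈ _ at hs₁
  change σ u (sUnder ρ σ u) = 0 at hσs₁
  change sBar ρ lamk i u ∈ _ at hs₂
  change lamk (i u (sBar ρ lamk i u)) = 0 at hls₂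
  set s₁ := sUnder ρ σ u with hs₁def
  set s₂ := sBar ρ lamk i u with hs₂def
  have hσmono := fun {a b : ℝ} => mul_sub_le_of_hasDerivAt (s := a) (t := b) (convex_Ioo (-ρ) ρ)
    (fun s hs => (hσ' s (hsub s hs)).1) (fun s hs => (hσ' s (hsub s hs)).2)
  have hlmono := fun {a b : ℝ} => mul_sub_le_of_hasDerivAt (s := a) (t := b) (convex_Ioo (-ρ) ρ)
    (fun s hs => (hi' s (hsub s hs)).2.2.1) (fun s hs => (hi' s (hsub s hs)).2.2.2)
  -- comparison of rarefaction curves and boundary layer curves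
  have hcompare : ∀ a ∈ Ioo (-ρ) ρ, ∀ τ : ℝ, a + τ ∈ Ioo (-ρ) ρ →
      ‖((i u (a + τ), 0) : State h m × ℝ) - y (i u a) τ‖ ≤
        (‖((r (i u a), 0) : State h m × ℝ) - X (i u a, 0)‖ + 2 * L * K * |τ|) * |τ| := by
    intro a ha τ haτ
    have hv := hiη u huρ a ha
    obtain ⟨hyv0, hyv⟩ := hy _ hv
    have hseg : ∀ t ∈ uIcc 0 τ, a + t ∈ Ioo (-η) η ∧ t ∈ Ioo (-η) η := by
      intro t ht
      rcases mem_uIcc.1 ht with h1 | h1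
      · exact ⟨⟨by linarith [ha.1], by linarith [haτ.2]⟩,
          ⟨by linarith [ha.1], by linarith [haτ.2, ha.1]⟩⟩
      · exact ⟨⟨by linarith [haτ.1], by linarith [ha.2]⟩,
          ⟨by linarith [ha.2, haτ.1], by linarith [haτ.2]⟩⟩
    have := norm_sub_le_of_two_fields (X₁ := fun w : State h m × ℝ => (r w.1, (0 : ℝ))) (X₂ := X)
      (α := fun t => (i u (a + t), (0 : ℝ))) (β := y (i u a)) (s := τ) hL hrK hXK hrL hXL
      (fun t ht => ⟨(hi' _ (hseg t ht).1).1,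
        ((hi' _ (hseg t ht).1).2.1.comp_const_add a t).prodMk (hasDerivAt_const t 0)⟩)
      (fun t ht => hyv t (hseg t ht).2) (by simp [hyv0])
    simpa using this
  by_cases hneg : lamk u < 0
  · by_cases hss : s < s₁
    · have hγ : gammaCurve ρ lamk i H σ p y u s = layerCurve p y u s := by
        simp only [gammaCurve, if_pos hneg, ← hs₁def, if_pos hss]
      have hlay := norm_sub_layerCurve_le (x := laxCurve i H u s) hP
        (hpP _ (hy' s (hsub s hsρ)).1)
      rw [hγ]
      refine hlay.trans ?_
      rcases le_or_gt s 0 with hs0 | hs0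
      · have hlax : laxCurve i H u s = i u s := if_pos hs0
        rw [hlax]
        have h1 := hcompare 0 h0ρ s (by simpa using hsρ)
        rw [zero_add, hi0] at h1
        -- The two fields agree at `i u s₂`, where the eigenvalue vanishes, and this state is at
        -- distance at most `K |s₂| ≤ K |lamk u| / c` from `u`.
        have h2 : ‖((r u, 0) : State h m × ℝ) - X (u, 0)‖ ≤ C₁ * |lamk u| := by
          have hmem0 : (u, (0 : ℝ)) ∈ B := by
            have := (hi' 0 (hsub 0 h0ρ)).1
            rwa [hi0] at this
          have hmem2 := (hi' s₂ (hsub s₂ hs₂)).1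
          have e1 := hvanish _ (hiη u huρ s₂ hs₂) hls₂
          have e2 : ‖(u, (0 : ℝ)) - (i u s₂, 0)‖ ≤ K * |s₂| := by
            have := norm_image_sub_le_of_hasDerivAt (convex_Ioo (-ρ) ρ)
              (fun s hs => (hi' s (hsub s hs)).2.1)
              (fun s hs => by simpa using hrK _ (hi' s (hsub s hs)).1) h0ρ hs₂
            simpa [hi0] using this
          have e3 : c * |s₂| ≤ |lamk u| := by
            rcases le_total 0 s₂ with h3 | h3
            · have := hlmono h0ρ hs₂ h3
              rw [hls₂, hi0] at this
              rw [abs_of_nonneg h3]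
              linarith [neg_abs_le (lamk u)]
            · have := hlmono hs₂ h0ρ h3
              rw [hls₂, hi0] at this
              rw [abs_of_nonpos h3]
              linarith [le_abs_self (lamk u)]
          have e4 : ((r u, 0) : State h m × ℝ) - X (u, 0) =
              (((r u, 0) : State h m × ℝ) - (r (i u s₂), 0)) - (X (u, 0) - X (i u s₂, 0)) := by
            rw [e1]; abel
          calc ‖((r u, 0) : State h m × ℝ) - X (u, 0)‖
              ≤ L * (K * |s₂|) + L * (K * |s₂|) := by
                rw [e4]
                exact (norm_sub_le _ _).trans (add_le_add
                  ((hrL _ hmem0 _ hmem2).trans (by gcongr))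
                  ((hXL _ hmem0 _ hmem2).trans (by gcongr)))
            _ = C₁ * (c * |s₂|) := by rw [← mul_assoc C₁, hC₁c]; ring
            _ ≤ C₁ * |lamk u| := by gcongr
        -- At `s = 0` the Lax curve uses the rarefaction branch but the speed uses the shock branch;
        -- there the distance is zero anyway.
        rcases hs0.eq_or_lt with hs00 | hs00
        · subst hs00
          simp only [abs_zero, mul_zero] at h1
          simp [le_antisymm h1 (norm_nonneg _)]
        · have hws : waveSpeed lamk i H σ u s = lamk (i u s) := by
            rw [waveSpeed, if_neg hs00.not_ge, hlax]
          rw [hws]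
          have h3 := hlmono hsρ h0ρ hs0
          rw [hi0] at h3
          -- Both terms are negative contributions to the eigenvalue at `i u s`: its value at `u`
          -- and its decrease backwards from `u`.
          have h4 : |lamk u| + c * |s| ≤ max (-(lamk (i u s))) 0 := by
            refine le_trans ?_ (le_max_left _ _)
            rw [abs_of_neg hneg, abs_of_neg hs00]
            linarith
          have h5 : C₁ * |lamk u| + 2 * L * K * |s| ≤ C₁ * max (-(lamk (i u s))) 0 := by
            rw [← hC₁c]
            nlinarith
          calc (1 + P) * ‖((i u s, 0) : State h m × ℝ) - y u s‖
              ≤ (1 + P) * ((C₁ * |lamk u| + 2 * L * K * |s|) * |s|) := by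
                gcongr
                exact h1.trans (by gcongr)
            _ ≤ (1 + P) * ((C₁ * max (-(lamk (i u s))) 0) * |s|) := by gcongr
            _ = ((1 + P) * C₁) * |s| * max (-(lamk (i u s))) 0 := by ring
            _ ≤ C * |s| * max (-(lamk (i u s))) 0 := by
                gcongr
      · have hlax : laxCurve i H u s = H u s := if_neg hs0.not_ge
        have hws : waveSpeed lamk i H σ u s = σ u s := by rw [waveSpeed, if_pos hs0.le]
        rw [hlax, hws]
        have hs₁0 : 0 < s₁ := hs0.trans hss
        have hIcc : ∀ t ∈ Icc 0 s₁, t ∈ Ioo (-η) η := fun t ht =>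
          hsub t ⟨by linarith [ht.1], by linarith [ht.2, hs₁.2]⟩
        have hyL : ∀ a ∈ Icc 0 s₁, ∀ b ∈ Icc 0 s₁, ‖X (y u a) - X (y u b)‖ ≤ L * K * |a - b| := by
          intro a ha b hb
          refine (hXL _ (hy' a (hIcc a ha)).1 _ (hy' b (hIcc b hb)).1).trans ?_
          rw [mul_assoc]
          gcongr
          exact norm_image_sub_le_of_hasDerivAt (convex_Icc 0 s₁)
            (fun t ht => (hy' t (hIcc t ht)).2)
            (fun t ht => hXK _ (hy' t (hIcc t ht)).1) ha hb
        -- The difference of the two curves vanishes at `0` by the initial conditions and at `s₁` by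
        -- `hmatch`.
        have h1 := norm_le_mul_of_two_zeros (D := fun t => ((H u t, 0) : State h m × ℝ) - y u t)
          (D' := fun t => ((H' u t, 0) : State h m × ℝ) - X (y u t)) (L := L + L * K) hs₁0
          (fun t ht => (((hH' t (hIcc t ht)).1).prodMk (hasDerivAt_const t 0)).sub
            (hy' t (hIcc t ht)).2)
          (fun a ha b hb => by
            have e1 : (((H' u a, 0) : State h m × ℝ) - X (y u a)) -
                (((H' u b, 0) : State h m × ℝ) - X (y u b)) =
                ((H' u a - H' u b, 0) : State h m × ℝ) - (X (y u a) - X (y u b)) := by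
              rw [sub_sub_sub_comm]
              congr 1
              simp
            rw [e1, add_mul]
            refine (norm_sub_le _ _).trans (add_le_add ?_ (hyL a ha b hb))
            simpa using (hH' a (hIcc a ha)).2 b (hIcc b hb))
          (by simp [hH0, hy0])
          (by simp [hmatch u huη hneg s₁ ⟨hs₁0, (hIcc s₁ (right_mem_Icc.2 hs₁0.le)).2⟩ hσs₁])
          (s := s) ⟨hs0.le, hss.le⟩
        have h2 := hσmono hsρ hs₁ hss.le
        rw [hσs₁] at h2
        have h3 : c * (s₁ - s) ≤ max (-(σ u s)) 0 := le_trans (by linarith) (le_max_left _ _)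
        calc (1 + P) * ‖((H u s, 0) : State h m × ℝ) - y u s‖
            ≤ (1 + P) * ((L + L * K) * s * (s₁ - s)) := by gcongr
          _ = (1 + P) * C₂ * |s| * (c * (s₁ - s)) := by
              rw [← hC₂c, abs_of_pos hs0]; ring
          _ ≤ (1 + P) * C₂ * |s| * max (-(σ u s)) 0 := by gcongr
          _ ≤ C * |s| * max (-(σ u s)) 0 := by
              gcongr
    · have hγ : gammaCurve ρ lamk i H σ p y u s = (laxCurve i H u s, 0) := by
        simp only [gammaCurve, if_pos hneg, ← hs₁def, if_neg hss]
      rw [hγ, sub_self, norm_zero]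
      positivity
  · by_cases hss : s < s₂
    · have hs₂0 : s₂ ≤ 0 := by
        by_contra! hcon
        have := hlmono h0ρ hs₂ hcon.le
        rw [hls₂, hi0] at this
        nlinarith [mul_pos hc hcon]
      have hs0 : s < 0 := hss.trans_le hs₂0
      have hlax : laxCurve i H u s = i u s := if_pos hs0.le
      have hlax₂ : laxCurve i H u s₂ = i u s₂ := if_pos hs₂0
      have hws : waveSpeed lamk i H σ u s = lamk (i u s) := by
        rw [waveSpeed, if_neg hs0.not_ge, hlax]
      have hγ : gammaCurve ρ lamk i H σ p y u s = layerCurve p y (i u s₂) (s - s₂) := by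
        simp only [gammaCurve, if_neg hneg, ← hs₂def, if_pos hss, hlax₂]
      -- The layer is restarted at `i u s₂`, so its time ranges over an interval of radius `2 ρ`;
      -- this is where `2 * ρ ≤ η` is needed.
      have hτ : s - s₂ ∈ Ioo (-η) η := ⟨by linarith [hsρ.1, hs₂.2], by linarith [hsρ.2, hs₂.1]⟩
      rw [hγ, hlax, hws]
      refine (norm_sub_layerCurve_le (x := i u s) hP
        (hpP _ ((hy _ (hiη u huρ s₂ hs₂)).2 _ hτ).1)).trans ?_
      have h1 := hcompare s₂ hs₂ (s - s₂) (by simpa using hsρ)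
      rw [hvanish _ (hiη u huρ s₂ hs₂) hls₂, sub_self, norm_zero, zero_add,
        add_sub_cancel] at h1
      have h2 : |s - s₂| ≤ |s| := by
        rw [abs_of_neg hs0, abs_of_neg (sub_neg.2 hss)]
        linarith
      have h3 := hlmono hsρ hs₂ hss.le
      rw [hls₂] at h3
      have h4 : c * |s - s₂| ≤ max (-(lamk (i u s))) 0 := by
        refine le_trans ?_ (le_max_left _ _)
        rw [abs_of_neg (sub_neg.2 hss)]
        linarith
      calc (1 + P) * ‖((i u s, 0) : State h m × ℝ) - y (i u s₂) (s - s₂)‖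
          ≤ (1 + P) * (2 * L * K * |s - s₂| * |s - s₂|) := by gcongr
        _ = (1 + P) * C₁ * |s - s₂| * (c * |s - s₂|) := by rw [← hC₁c]; ring
        _ ≤ (1 + P) * C₁ * |s| * max (-(lamk (i u s))) 0 := by gcongr
        _ ≤ C * |s| * max (-(lamk (i u s))) 0 := by
            gcongr
    · have hγ : gammaCurve ρ lamk i H σ p y u s = (laxCurve i H u s, 0) := by
        simp only [gammaCurve, if_neg hneg, ← hs₂def, if_neg hss]
      rw [hγ, sub_self, norm_zero]
      positivity

/-! ### Matching of shocks and layers, and the choice of uniform constants. -/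

/-- By Rolle's theorem for `⟨e, φ⟩`. It ensures that neither the Hugoniot nor the layer curve
returns to `u`, as the fold argument requires. -/
theorem ne_of_inner_hasDerivAt_pos {E : Type*} [NormedAddCommGroup E] [InnerProductSpace ℝ E]
    {e : E} {φ φ' : ℝ → E} {s : ℝ} (hs : 0 < s) (hφ : ∀ t ∈ Icc 0 s, HasDerivAt φ (φ' t) t)
    (hpos : ∀ t ∈ Icc 0 s, 0 < inner ℝ e (φ' t)) : φ 0 ≠ φ s := by
  intro heq
  have hd : ∀ t ∈ Icc 0 s, HasDerivAt (fun t => inner ℝ e (φ t)) (inner ℝ e (φ' t)) t :=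
    fun t ht => (innerSL ℝ e).hasFDerivAt.comp_hasDerivAt t (hφ t ht)
  obtain ⟨t, ht, ht0⟩ := exists_hasDerivAt_eq_zero hs
    (fun t ht => (hd t ht).continuousAt.continuousWithinAt) (by simp only [heq])
    (fun t ht => hd t (Ioo_subset_Icc_self ht))
  exact (hpos t (Ioo_subset_Icc_self ht)).ne' ht0

theorem ContDiffAt.exists_eventually_norm_sub_le {E F : Type*} [NormedAddCommGroup E]
    [NormedSpace ℝ E] [NormedAddCommGroup F] [NormedSpace ℝ F] {f : E → F} {x₀ : E}
    (hf : ContDiffAt ℝ 1 f x₀) :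
    ∃ L : ℝ, 0 ≤ L ∧ ∃ t ∈ 𝓝 x₀, ∀ x ∈ t, ∀ x' ∈ t, ‖f x - f x'‖ ≤ L * ‖x - x'‖ := by
  obtain ⟨L, t, ht, hL⟩ := hf.exists_lipschitzOnWith
  exact ⟨L, L.2, t, ht, fun x hx x' hx' => by
    simpa [dist_eq_norm] using hL.dist_le_mul x hx x' hx'⟩

/-- On the zero set of the shock speed, the Hugoniot curve and the boundary layer curve meet. -/
theorem ViscousSystem.layer_eq_hugoniot {h m : ℕ} {S : ViscousSystem h m} (hS : S.IsNormalForm)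
    (hA : ∀ u ∈ S.U, (S.A11 u).det ≠ 0) {ustar e u x : State h m} {W : Set (State h m × ℝ)}
    {p : State h m × ℝ → Par m} (hp : S.IsCenterManifold ustar W p) {δ s : ℝ}
    (hfold : ∀ a ∈ Metric.ball ustar δ, ∀ b ∈ Metric.ball ustar δ, ∀ c ∈ Metric.ball ustar δ,
      S.f (S.v a) = S.f (S.v b) → S.f (S.v a) = S.f (S.v c) → a ≠ b → a ≠ c → b = c)
    {y : ℝ → State h m × ℝ} (hs : 0 < s) (hy0 : y 0 = (u, 0))
    (hy : ∀ t ∈ Icc 0 s, HasDerivAt y (S.rc p (y t), S.thetac p (y t)) t)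
    (hyW : ∀ t ∈ Icc 0 s, y t ∈ W ∧ (y t).1 ∈ Metric.ball ustar δ ∧
      0 < inner ℝ e (S.rc p (y t)) ∧
      S.blMatrix (y t).1 ((y t).2 • S.rc p (y t)) *ᵥ p (y t) =
        S.thetac p (y t) • (S.B22 (y t).1 *ᵥ p (y t)) +
        (y t).2 • (S.B22 (y t).1 *ᵥ (fderiv ℝ p (y t) (S.rc p (y t), S.thetac p (y t)))))
    (hys : (y s).2 = 0) (hx : x ∈ Metric.ball ustar δ) (hux : u ≠ x)
    (hflux : S.f (S.v x) = S.f (S.v u)) : y s = (x, 0) := by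
  have m0 : (0 : ℝ) ∈ Icc 0 s := left_mem_Icc.2 hs.le
  have ms : s ∈ Icc 0 s := right_mem_Icc.2 hs.le
  -- The viscous part of the total flux carries a factor `z`, which vanishes at both ends, so
  -- constancy reduces to equality of the fluxes `f`.
  have hconst : totalFlux S p (y s) = totalFlux S p (y 0) := by
    have hd : ∀ t ∈ Icc 0 s, HasDerivAt (fun t => totalFlux S p (y t)) 0 t := fun t ht => by
      obtain ⟨T, hT, hT0⟩ := hasFDerivAt_totalFlux hS hA hp (hyW t ht).1 (hyW t ht).2.2.2
      rw [← hT0]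
      exact hT.comp_hasDerivAt t (hy t ht)
    have := norm_image_sub_le_of_hasDerivAt (convex_Icc 0 s) hd (K := 0) (fun t _ => by simp) ms m0
    rw [zero_mul] at this
    exact sub_eq_zero.1 (norm_le_zero_iff.1 this)
  simp only [totalFlux, hys, hy0, zero_smul, sub_zero, Function.comp_apply] at hconst
  have hne : u ≠ (y s).1 := by
    have := ne_of_inner_hasDerivAt_pos (e := e) (φ := fun t => (y t).1)
      (φ' := fun t => S.rc p (y t)) hs (fun t ht => (hy t ht).fst)
      (fun t ht => (hyW t ht).2.2.1)
    simpa [hy0] using this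
  have hu : u ∈ Metric.ball ustar δ := by
    have := (hyW 0 m0).2.1
    rwa [hy0] at this
  exact Prod.ext (hfold u hu _ (hyW s ms).2.1 x hx hconst.symm hflux.symm hne hux) hys


theorem lemmal {h m : ℕ} (S : ViscousSystem h m)
    -- the standing assumptions, with invertible `A₁₁`
    (hS : S.IsNormalForm) (hKS : S.KawashimaShizuta)
    (hA : ∀ u ∈ S.U, (S.A11 u).det ≠ 0)
    (lam : Fin (h + m) → State h m → ℝ) (k : Fin (h + m)) (ustar : State h m)
    (hlam : S.BoundaryCharacteristic lam k ustar)
    -- the `k`-th field is genuinely nonlinear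
    (r : State h m → State h m) (hr : S.GenuinelyNonlinear (lam k) r)
    -- a center manifold, with the matching normalization of the eigenvectors
    (W : Set (State h m × ℝ)) (p : State h m × ℝ → Par m)
    (hp : S.IsCenterManifold ustar W p)
    (hrp : ∀ u, (u, (0 : ℝ)) ∈ W → lam k u = 0 → S.rc p (u, 0) = r u)
    -- rarefaction curves, Hugoniot curves and boundary layer curves
    (i : State h m → ℝ → State h m) (hi : S.IsRarefactionCurve ustar r i)
    (H : State h m → ℝ → State h m) (σ : State h m → ℝ → ℝ)
    (hH : S.IsHugoniotCurve ustar (lam k) r H σ)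
    (y : State h m → ℝ → State h m × ℝ) (hy : S.IsLayerCurve ustar W p y)
    -- the choice of the parameter on the shock curve: `σ(u, ·)` and `z_c` have the same positive
    -- zero when `lam k u < 0`
    (hpar : ∀ᶠ q : State h m × ℝ in 𝓝 (ustar, 0),
      lam k q.1 < 0 → 0 < q.2 → (σ q.1 q.2 = 0 ↔ (y q.1 q.2).2 = 0)) :
    ∃ C ρ ν : ℝ, 0 < C ∧ 0 < ρ ∧ 0 < ν ∧ ∀ u : State h m, ‖u - ustar‖ ≤ ν →
      (∃! s, s ∈ Ioo (-ρ) ρ ∧ σ u s = 0) ∧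
      (∃! s, s ∈ Ioo (-ρ) ρ ∧ lam k (i u s) = 0) ∧
      ∀ s ∈ Ioo (-ν) ν,
        ‖((laxCurve i H u s, 0) : State h m × Par m) - gammaCurve ρ (lam k) i H σ p y u s‖
          ≤ C * |s| * max (-(waveSpeed (lam k) i H σ u s)) 0 := by
  have hU := hlam.mem_U
  set w₀ : State h m × ℝ := (ustar, 0) with hw₀
  set e : State h m := r ustar with he
  have hee : 0 < inner ℝ e e :=
    real_inner_self_pos.2 fun h0 => hr.ne_zero hU (by rw [← he, h0]; rfl)
  obtain ⟨d, hd, hgnl⟩ := hr.gnl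
  obtain ⟨δ₁, hδ₁, hfold⟩ := S.exists_ball_flux_fold hS hlam hr
  obtain ⟨hH2, hσ2⟩ := hH.contDiffAt
  have hσ'0 := S.two_mul_deriv_shockSpeed hS hlam hr hH
  obtain ⟨ρ₁, hρ₁, -, -, hRH⟩ := hH
  set X : State h m × ℝ → State h m × ℝ := fun w => (S.rc p w, S.thetac p w) with hX
  set Hd : State h m × ℝ → State h m :=
    fun q => fderiv ℝ (fun q : State h m × ℝ => H q.1 q.2) q (0, 1) with hHd
  set σd : State h m × ℝ → ℝ :=
    fun q => fderiv ℝ (fun q : State h m × ℝ => σ q.1 q.2) q (0, 1) with hσd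
  -- regularity at the base point
  have hrc1 : ContDiffAt ℝ 1 (S.rc p) w₀ :=
    (S.contDiffAt_rc hS hA hp hp.base_mem).of_le (by norm_num)
  have hX1 : ContDiffAt ℝ 1 X w₀ :=
    hrc1.prodMk (S.contDiffAt_thetac hS hA hp hp.base_mem (by simp [hw₀]))
  have hr1 : ContDiffAt ℝ 1 (fun w : State h m × ℝ => (r w.1, (0 : ℝ))) w₀ :=
    (((hr.contDiffAt_r hS hU).of_le (by norm_num)).comp w₀ contDiffAt_fst).prodMk contDiffAt_const
  have hHd1 : ContDiffAt ℝ 1 Hd w₀ :=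
    (hH2.fderiv_right (m := 1) (by norm_num)).clm_apply contDiffAt_const
  have hσd1 : ContDiffAt ℝ 1 σd w₀ :=
    (hσ2.fderiv_right (m := 1) (by norm_num)).clm_apply contDiffAt_const
  have hpc : ContinuousAt p w₀ :=
    (hp.regular.contDiffAt (hp.isOpen.mem_nhds hp.base_mem)).continuousAt
  have hHd0 : Hd w₀ = e :=
    (hasDerivAt_snd_of_differentiableAt (hH2.differentiableAt (by norm_num))).unique
      (hRH ustar (Metric.mem_ball_self hρ₁)).2.1
  have hrc0 : S.rc p w₀ = e := hrp ustar hp.base_mem hlam.vanish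
  obtain ⟨L₁, hL₁, t₁, ht₁, hLip₁⟩ := hX1.exists_eventually_norm_sub_le
  obtain ⟨L₂, hL₂, t₂, ht₂, hLip₂⟩ := hr1.exists_eventually_norm_sub_le
  obtain ⟨L₃, hL₃, t₃, ht₃, hLip₃⟩ := hHd1.exists_eventually_norm_sub_le
  obtain ⟨K₁, hK₁, hbd₁⟩ := hX1.continuousAt.exists_norm_le
  obtain ⟨K₂, hK₂, hbd₂⟩ := hr1.continuousAt.exists_norm_le
  obtain ⟨P, hP, hbdP⟩ := hpc.exists_norm_le
  set L := max L₁ (max L₂ L₃)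
  have hLL₁ : L₁ ≤ L := le_max_left _ _
  have hLL₂ : L₂ ≤ L := (le_max_left _ _).trans (le_max_right _ _)
  have hLL₃ : L₃ ≤ L := (le_max_right _ _).trans (le_max_right _ _)
  -- a neighbourhood of the base point
  have hrcpos : ∀ᶠ w in 𝓝 w₀, 0 < inner ℝ e (S.rc p w) :=
    (continuousAt_const.inner hrc1.continuousAt).eventually (lt_mem_nhds (by simpa only [hrc0] using hee))
  have hHdpos : ∀ᶠ w in 𝓝 w₀, 0 < inner ℝ e (Hd w) :=
    (continuousAt_const.inner hHd1.continuousAt).eventually (lt_mem_nhds (by simpa only [hHd0] using hee))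
  -- At the base point `∂_s σ` is half of `∇λ_k · r_k`, hence at least `d / 2`; the constant `d / 4`
  -- persists nearby.
  have hσdpos : ∀ᶠ w in 𝓝 w₀, d / 4 < σd w := by
    refine hσd1.continuousAt.eventually (lt_mem_nhds ?_)
    have h1 : 2 * σd w₀ = fderiv ℝ (lam k) ustar e := hσ'0
    linarith [(hgnl ustar hU).2]
  have hHball : ∀ᶠ w in 𝓝 w₀, H w.1 w.2 ∈ Metric.ball ustar δ₁ := by
    refine hH2.continuousAt.eventually (Metric.isOpen_ball.mem_nhds ?_)
    change H ustar 0 ∈ _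
    rw [(hRH ustar (Metric.mem_ball_self hρ₁)).1]
    exact Metric.mem_ball_self hδ₁
  have hball₁ : ∀ᶠ w in 𝓝 w₀, w.1 ∈ Metric.ball ustar δ₁ :=
    continuousAt_fst.eventually (Metric.ball_mem_nhds _ hδ₁)
  have hHdiff : ∀ᶠ w in 𝓝 w₀, DifferentiableAt ℝ (fun q : State h m × ℝ => H q.1 q.2) w :=
    (hH2.eventually (by simp)).mono fun w hw => hw.differentiableAt (by norm_num)
  have hσdiff : ∀ᶠ w in 𝓝 w₀, DifferentiableAt ℝ (fun q : State h m × ℝ => σ q.1 q.2) w :=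
    (hσ2.eventually (by simp)).mono fun w hw => hw.differentiableAt (by norm_num)
  -- A single ball of `State h m × ℝ` serves both for the pairs `(u, s)`, arguments of `H` and `σ`,
  -- and for the pairs `(u, z)`, arguments of `p` and `X`.
  obtain ⟨δ, hδ, hB⟩ := Metric.eventually_nhds_iff_ball.1
    (((hp.isOpen.eventually_mem hp.base_mem).and (S.eventually_invariance hS hA hp)).and
      (((hbd₁.and hbd₂).and (hbdP.and hrcpos)).and
      (((hHdpos.and hσdpos).and (hHball.and hball₁)).and ((hHdiff.and hσdiff).and
      (hpar.and ((eventually_mem_nhds_iff.2 ht₁ |>.mono fun _ h => mem_of_mem_nhds h).and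
      ((eventually_mem_nhds_iff.2 ht₂ |>.mono fun _ h => mem_of_mem_nhds h).and
      (eventually_mem_nhds_iff.2 ht₃ |>.mono fun _ h => mem_of_mem_nhds h))))))))
  obtain ⟨η₁, hη₁, hiu⟩ := hi.exists_uniform (x₀ := ustar) continuousAt_id
    (hr.contDiffAt_r hS hU).continuousAt hδ
  obtain ⟨η₂, hη₂, hyu⟩ := hy.exists_uniform (x₀ := ustar) (by fun_prop) hX1.continuousAt hδ
  set η := min (min δ ρ₁) (min η₁ η₂)
  have hη : 0 < η := by positivity
  have hηδ : η ≤ δ := (min_le_left _ _).trans (min_le_left _ _)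
  have hηρ₁ : η ≤ ρ₁ := (min_le_left _ _).trans (min_le_right _ _)
  have hηη₁ : η ≤ η₁ := (min_le_right _ _).trans (min_le_left _ _)
  have hηη₂ : η ≤ η₂ := (min_le_right _ _).trans (min_le_right _ _)
  -- A second, smaller radius keeps `i u s` among the initial states for which the layer curves are
  -- controlled, since a layer may start at a rarefaction state.
  obtain ⟨η₃, hη₃, hiη⟩ := hi.exists_uniform (x₀ := ustar) continuousAt_id
    (hr.contDiffAt_r hS hU).continuousAt hη
  have hIoo : ∀ {a b : ℝ}, a ≤ b → Ioo (-a) a ⊆ Ioo (-b) b := fun hab =>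
    Ioo_subset_Ioo (neg_le_neg hab) hab
  have hmemB : ∀ u ∈ Metric.ball ustar η, ∀ s ∈ Ioo (-η) η, (u, s) ∈ Metric.ball w₀ δ := by
    intro u hu s hs
    rw [Metric.mem_ball, Prod.dist_eq, max_lt_iff, Real.dist_eq, sub_zero]
    exact ⟨(Metric.mem_ball.1 hu).trans_le hηδ, (abs_lt.2 hs).trans_le hηδ⟩
  have hi' : ∀ u ∈ Metric.ball ustar η, i u 0 = u ∧ ∀ s ∈ Ioo (-η) η,
      (i u s, (0 : ℝ)) ∈ Metric.ball w₀ δ ∧ HasDerivAt (i u) (r (i u s)) s ∧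
      HasDerivAt (fun s => lam k (i u s)) (fderiv ℝ (lam k) (i u s) (r (i u s))) s ∧
      d / 4 ≤ fderiv ℝ (lam k) (i u s) (r (i u s)) := by
    intro u hu
    obtain ⟨h0, h1⟩ := hiu u (Metric.ball_subset_ball hηη₁ hu)
    refine ⟨h0, fun s hs => ?_⟩
    obtain ⟨h2, h3⟩ := h1 s (hIoo hηη₁ hs)
    have h4 : (i u s, (0 : ℝ)) ∈ Metric.ball w₀ δ := by
      rw [Metric.mem_ball, Prod.dist_eq, max_lt_iff, Real.dist_eq, sub_zero, abs_zero]
      exact ⟨h2, hδ⟩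
    obtain ⟨h5, h6⟩ := hgnl _ (hp.fst_mem _ (hB _ h4).1.1)
    exact ⟨h4, h3, h5.hasFDerivAt.comp_hasDerivAt s h3, by linarith⟩
  have hy' : ∀ u ∈ Metric.ball ustar η, y u 0 = (u, 0) ∧ ∀ s ∈ Ioo (-η) η,
      y u s ∈ Metric.ball w₀ δ ∧ HasDerivAt (y u) (X (y u s)) s := fun u hu =>
    ⟨(hyu u (Metric.ball_subset_ball hηη₂ hu)).1, fun s hs =>
      (hyu u (Metric.ball_subset_ball hηη₂ hu)).2 s (hIoo hηη₂ hs)⟩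
  have hH' : ∀ u ∈ Metric.ball ustar η, H u 0 = u ∧ ∀ s ∈ Ioo (-η) η,
      HasDerivAt (H u) (Hd (u, s)) s ∧
      ∀ t ∈ Ioo (-η) η, ‖Hd (u, s) - Hd (u, t)‖ ≤ L * |s - t| := by
    intro u hu
    refine ⟨(hRH u (Metric.ball_subset_ball hηρ₁ hu)).1, fun s hs =>
      ⟨hasDerivAt_snd_of_differentiableAt (hB _ (hmemB u hu s hs)).2.2.2.1.1, fun t ht => ?_⟩⟩
    refine (hLip₃ _ (hB _ (hmemB u hu s hs)).2.2.2.2.2.2.2 _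
      (hB _ (hmemB u hu t ht)).2.2.2.2.2.2.2).trans ?_
    have : ‖((u, s) : State h m × ℝ) - (u, t)‖ = |s - t| := by simp
    rw [this]
    gcongr
  have hσ' : ∀ u ∈ Metric.ball ustar η, σ u 0 = lam k u ∧ ∀ s ∈ Ioo (-η) η,
      HasDerivAt (σ u) (σd (u, s)) s ∧ d / 4 ≤ σd (u, s) := fun u hu =>
    ⟨(hRH u (Metric.ball_subset_ball hηρ₁ hu)).2.2.1, fun s hs =>
      ⟨hasDerivAt_snd_of_differentiableAt (hB _ (hmemB u hu s hs)).2.2.2.1.2,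
        (hB _ (hmemB u hu s hs)).2.2.1.1.2.le⟩⟩
  -- The choice of the shock parameter enters here: `σ u s = 0` gives `z_c = 0` at the same `s`, and
  -- the fold property then identifies the two states.
  have hmatch : ∀ u ∈ Metric.ball ustar η, lam k u < 0 → ∀ s ∈ Ioo 0 η, σ u s = 0 →
      y u s = (H u s, 0) := by
    intro u hu hneg s hs hσs
    have hIcc : ∀ t ∈ Icc 0 s, t ∈ Ioo (-η) η := fun t ht =>
      ⟨by linarith [ht.1], by linarith [ht.2, hs.2]⟩
    have hs' : s ∈ Ioo (-η) η := ⟨by linarith [hs.1], hs.2⟩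
    have hBs := hB _ (hmemB u hu s hs')
    have hne : u ≠ H u s := by
      have := ne_of_inner_hasDerivAt_pos (e := e) hs.1
        (fun t ht => ((hH' u hu).2 t (hIcc t ht)).1)
        (fun t ht => (hB _ (hmemB u hu t (hIcc t ht))).2.2.1.1.1)
      rwa [(hH' u hu).1] at this
    refine S.layer_eq_hugoniot hS hA (e := e) hp hfold hs.1 (hy' u hu).1
      (fun t ht => ((hy' u hu).2 t (hIcc t ht)).2) (fun t ht => ?_)
      ((hBs.2.2.2.2.1 hneg hs.1).1 hσs) hBs.2.2.1.2.1 hne ?_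
    · have := hB _ ((hy' u hu).2 t (hIcc t ht)).1
      exact ⟨this.1.1, this.2.2.1.2.2, this.2.1.2.2, this.1.2⟩
    · have := ((hRH u (Metric.ball_subset_ball hηρ₁ hu)).2.2.2 s (hIoo hηρ₁ hs')).2
      rw [hσs, zero_smul] at this
      exact sub_eq_zero.1 this
  have hvanish : ∀ u ∈ Metric.ball ustar η, lam k u = 0 → X (u, 0) = (r u, 0) := by
    intro u hu h0
    have huW := (hB _ (hmemB u hu 0 ⟨by linarith, hη⟩)).1.1
    exact Prod.ext (hrp u huW h0)
      (S.thetac_eq_zero hS hA hr (hp.fst_mem _ huW) h0 (hrp u huW h0))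
  obtain ⟨C, ν, hC, hν, hmain⟩ := exists_norm_sub_gammaCurve_le (ustar := ustar) (lamk := lam k)
    (r := r) (X := X) (p := p) (i := i) (H := H) (H' := fun u s => Hd (u, s)) (σ := σ)
    (σ' := fun u s => σd (u, s)) (y := y) (B := Metric.ball w₀ δ) (K := max K₁ K₂) (L := L)
    (P := P) (c := d / 4) (ρ := min η₃ (η / 2)) (η := η) (hK₁.trans (le_max_left _ _))
    (hL₁.trans hLL₁) hP (by positivity) (by positivity) (by linarith [min_le_right η₃ (η / 2)])
    (hr.contDiffAt_lam hS hU).continuousAt hlam.vanish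
    (fun w hw => (hB w hw).2.1.1.2.trans (le_max_right _ _))
    (fun w hw => (hB w hw).2.1.1.1.trans (le_max_left _ _))
    (fun w hw w' hw' => (hLip₂ _ (hB w hw).2.2.2.2.2.2.1 _ (hB w' hw').2.2.2.2.2.2.1).trans
      (by gcongr))
    (fun w hw w' hw' => (hLip₁ _ (hB w hw).2.2.2.2.2.1 _ (hB w' hw').2.2.2.2.2.1).trans
      (by gcongr))
    (fun w hw => (hB w hw).2.1.2.1) hi'
    (fun u hu s hs => ((hiη u (Metric.ball_subset_ball (min_le_left _ _) hu)).2 s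
      (hIoo (min_le_left _ _) hs)).1)
    hy' hH' hσ' hmatch hvanish
  exact ⟨C, min η₃ (η / 2), ν, hC, by positivity, hν, hmain⟩
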